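/- **Setting.** Let $(M,g)$ be a time-oriented four-dimensional (Hausdorff, smooth) space-time of signature $(+,-,-,-)$ with Levi-Civita connection $\nabla$ and energy-momentum tensor $T_{ab}$ (units $G=c=1$). A *non-expanding horizon* $\mathcal H\subset M$ is a smoothly embedded null hypersurface diffeomorphic to $\mathbb R\times S^2$ such that (1) every null normal $l^a$ of $\mathcal H$ has vanishing expansion $q^{ab}\nabla_a l_b$, where $q^{ab}=-m^a\bar m^b-\bar m^a m^b$ for any completion of $l^a$ to a null tetrad; (2) Einstein's equations $\mathrm{Ric}_{ab}-\tfrac12 R\,g_{ab}=8\pi T_{ab}$ hold on $\mathcal H$ (with $\mathrm{Ric}(v,w)=\operatorname{tr}(u\mapsto R(u,v)w)$, $R(u,v)w=\nabla_u\nabla_v w-\nabla_v\nabla_u w-\nabla_{[u,v]}w$); (3) for every future pointing null normal $l^a$ the vector $T^a{}_b l^b$ is future pointing causal or zero. A *null tetrad* $(l^a,n^a,m^a,\bar m^a)$ consists of real vectors $l^a,n^a$ and a complex vector $m^a$ with $l\cdot n=1$, $m\cdot\bar m=-1$ and all other scalar products (of $l,n,m,\bar m$) equal to zero. A *spherical cut*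 $\mathcal S_0\subset\mathcal H$ is an embedded two-sphere, transversal to the generators of $\mathcal H$ (the orbits of its null normals in $\mathcal H$), which every generator meets exactly once. **Theorem.** Let $l^a$ be a smooth null normal of a non-expanding horizon $\mathcal H$, let $\mathcal S_0$ be a spherical cut of $\mathcal H$, let $U\subset\mathcal S_0$ be an open piece of it, and let $\mathcal H_U\subset\mathcal H$ be the union of the generators through $U$. Let $(l^a,n^a,m^a,\bar m^a)$ be a null tetrad given at the points of $U$, and let $m^a$ be extended to a smooth complex vector field on $\mathcal H_U$ by Lie dragging along $l^a$: $\pounds_l m^a=[l,m]^a=0$ on $\mathcal H_U$. (As usual, fields on the horizon are represented by extensions to $M$ that are smooth near each of the points concerned.) Then $$ l^a m_a=0,\qquad m^a m_a=0,\qquad m^a\bar m_a=-1 \qquad\text{everywhere on } \mathcal H_U. $$ Consequently there is at each point of $\mathcal H_U$ exactly one real vector $n^a$ that completes $l^a,m^a,\bar m^a$ to a null tetrad; with it, the spin coefficient $\epsilon=\tfrac12\left(n^a\,l^b\nabla_b l_a-\bar m^a\,l^b\nabla_b m_a\right)$ is real on $\mathcal H_U$: $\epsilon-\bar\epsilon=0$.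 (Every point of $\mathcal S_0$ has a neighbourhood $U$ in $\mathcal S_0$ on which such a tetrad exists, and each generator meets $\mathcal S_0$, so this covers all of $\mathcal H$. No continuous $m^a$ exists on the whole sphere.) -/

import Mathlib

open scoped Manifold ContDiff

noncomputable section

namespace NEH

/-- Model space of four-dimensional space-times. -/
abbrev E4 : Type := EuclideanSpace ℝ (Fin 4)

/-- The unit two-sphere. -/
abbrev S2 : Type := Metric.sphere (0 : EuclideanSpace ℝ (Fin 3)) 1

/-- A vector `re + i im` of the complexification `V ⊕ iV` of a real vector space `V`. -/
@[ext]
structure CVec (V : Type*) where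
  re : V
  im : V

namespace CVec

variable {V : Type*} [AddCommGroup V] [Module ℝ V]

/-- A real vector, seen in the complexification. -/
def ofReal (v : V) : CVec V := ⟨v, 0⟩

/-- Complex conjugation. -/
def conj (u : CVec V) : CVec V := ⟨u.re, -u.im⟩

/-- The complex-linear extension of a real linear map. -/
def map [TopologicalSpace V] (A : V →L[ℝ] V) (u : CVec V) : CVec V := ⟨A u.re, A u.im⟩

/-- The complex-bilinear extension of a real bilinear form. -/
def bilin [TopologicalSpace V] (B : V →L[ℝ] V →L[ℝ] ℝ) (u v : CVec V) : ℂ :=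
  ⟨B u.re v.re - B u.im v.im, B u.re v.im + B u.im v.re⟩

end CVec

section Spacetime

variable (M : Type*) [TopologicalSpace M] [ChartedSpace E4 M] [IsManifold (𝓡 4) ∞ M]

/-- A smooth Lorentzian metric of signature `(+,-,-,-)` on a four-dimensional manifold. -/
structure LorentzMetric where
  inner (x : M) : TangentSpace (𝓡 4) x →L[ℝ] TangentSpace (𝓡 4) x →L[ℝ] ℝ
  symm (x : M) (v w : TangentSpace (𝓡 4) x) : inner x v w = inner x w v
  signature (x : M) : ∃ e : Module.Basis (Fin 4) ℝ (TangentSpace (𝓡 4) x),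
    ∀ i j, inner x (e i) (e j) = if i = j then (if i = 0 then 1 else -1) else 0
  contMDiff : ContMDiff (𝓡 4) ((𝓡 4).prod 𝓘(ℝ, E4 →L[ℝ] E4 →L[ℝ] ℝ)) ∞
    (fun x ↦ Bundle.TotalSpace.mk' (E4 →L[ℝ] E4 →L[ℝ] ℝ)
      (E := fun x : M ↦ TangentSpace (𝓡 4) x →L[ℝ] TangentSpace (𝓡 4) x →L[ℝ] ℝ) x (inner x))

variable {M}

/-- A vector field, as a map into the tangent bundle, is smooth at `x`. -/
def SmoothFieldAt (X : Π x : M, TangentSpace (𝓡 4) x) (x : M) : Prop :=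
  ContMDiffAt (𝓡 4) ((𝓡 4).prod 𝓘(ℝ, E4)) ∞ (fun y ↦ (⟨y, X y⟩ : TangentBundle (𝓡 4) M)) x

/-- A vector field, as a map into the tangent bundle, is differentiable at `x`. -/
def DiffFieldAt (X : Π x : M, TangentSpace (𝓡 4) x) (x : M) : Prop :=
  MDifferentiableAt (𝓡 4) ((𝓡 4).prod 𝓘(ℝ, E4)) (fun y ↦ (⟨y, X y⟩ : TangentBundle (𝓡 4) M)) x

/-- A time orientation, given by a continuous timelike vector field. -/
structure TimeOrientation (g : LorentzMetric M) where
  field (x : M) : TangentSpace (𝓡 4) x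
  continuous : Continuous (fun x ↦ (⟨x, field x⟩ : TangentBundle (𝓡 4) M))
  timelike (x : M) : 0 < g.inner x (field x) (field x)

/-- `v` is a (nonzero) causal vector which points to the future. -/
def TimeOrientation.FuturePointing {g : LorentzMetric M} (τ : TimeOrientation g) {x : M}
    (v : TangentSpace (𝓡 4) x) : Prop :=
  0 ≤ g.inner x v v ∧ 0 < g.inner x (τ.field x) v

/-- An affine connection on `M`; `∇ Y x u` is the derivative of `Y` at `x` along `u`. -/
abbrev Connection (M : Type*) [TopologicalSpace M] [ChartedSpace E4 M]
    [IsManifold (𝓡 4) ∞ M] : Type _ :=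
  CovariantDerivative (𝓡 4) E4 (fun x : M ↦ TangentSpace (𝓡 4) x)

/-- `D` is the Levi-Civita connection of `g`: the smooth, torsion-free connection that is
compatible with `g`. -/
structure IsLeviCivita (g : LorentzMetric M) (D : Connection M) : Prop where
  smooth : CovariantDerivative.ContMDiffCovariantDerivative D ∞
  torsion_free : ∀ (X Y : Π x : M, TangentSpace (𝓡 4) x) (x : M),
    DiffFieldAt X x → DiffFieldAt Y x →
      D Y x (X x) - D X x (Y x) = VectorField.mlieBracket (𝓡 4) X Y x
  metric : ∀ (Y Z : Π x : M, TangentSpace (𝓡 4) x) (x : M) (u : TangentSpace (𝓡 4) x),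
    DiffFieldAt Y x → DiffFieldAt Z x →
      mfderiv (𝓡 4) 𝓘(ℝ, ℝ) (fun y ↦ g.inner y (Y y) (Z y)) x u =
        g.inner x (D Y x u) (Z x) + g.inner x (Y x) (D Z x u)

/-- `R(X,Y)Z = ∇_X ∇_Y Z - ∇_Y ∇_X Z - ∇_{[X,Y]} Z` at the point `x`. -/
def curvatureField (D : Connection M) (X Y Z : Π x : M, TangentSpace (𝓡 4) x) (x : M) :
    TangentSpace (𝓡 4) x :=
  D (fun y ↦ D Z y (Y y)) x (X x) - D (fun y ↦ D Z y (X y)) x (Y x)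
    - D Z x (VectorField.mlieBracket (𝓡 4) X Y x)

/-- The Riemann tensor `R(u,v)w` at a point, computed with local smooth extensions (constant in
the preferred chart at `x`) of the three vectors. -/
def riemann (D : Connection M) (x : M) (u v w : TangentSpace (𝓡 4) x) : TangentSpace (𝓡 4) x :=
  curvatureField D (FiberBundle.extend E4 u) (FiberBundle.extend E4 v)
    (FiberBundle.extend E4 w) x

/-- The standard basis of the tangent space at `x` (the coordinate basis of the preferred chart
at `x`). -/
def coordBasis (x : M) : Module.Basis (Fin 4) ℝ (TangentSpace (𝓡 4) x) :=
  (EuclideanSpace.basisFun (Fin 4) ℝ).toBasis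

/-- The Ricci tensor `Ric(v,w)`, the trace of `u ↦ R(u,v)w`. -/
def ricci (D : Connection M) (x : M) (v w : TangentSpace (𝓡 4) x) : ℝ :=
  ∑ i, (coordBasis x).repr (riemann D x (coordBasis x i) v w) i

/-- The scalar curvature, the trace of the Ricci tensor with respect to `g`. -/
def scalarCurvature (g : LorentzMetric M) (D : Connection M) (x : M) : ℝ :=
  ∑ i, ∑ j, (Matrix.of fun a b ↦ g.inner x (coordBasis x a) (coordBasis x b))⁻¹ i j *
    ricci D x (coordBasis x i) (coordBasis x j)

/-- A two-index covariant tensor field, such as the energy-momentum tensor. -/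
abbrev TwoTensor (M : Type*) [TopologicalSpace M] [ChartedSpace E4 M] : Type _ :=
  Π x : M, TangentSpace (𝓡 4) x →L[ℝ] TangentSpace (𝓡 4) x →L[ℝ] ℝ

/-- Einstein's equations `Ric - R g / 2 = 8 π T` at `x` (in units with `G = c = 1`). -/
def EinsteinAt (g : LorentzMetric M) (D : Connection M) (T : TwoTensor M) (x : M) : Prop :=
  ∀ u v : TangentSpace (𝓡 4) x,
    ricci D x u v - scalarCurvature g D x / 2 * g.inner x u v = 8 * Real.pi * T x u v

/-! ### Null tetrads -/

/-- The contractions that characterize a Newman-Penrose null tetrad `(l, n, m, m̄)` at `x`: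
`l·n = 1`, `m·m̄ = -1`, all other products vanish. -/
structure IsNullTetrad (g : LorentzMetric M) (x : M) (l n : TangentSpace (𝓡 4) x)
    (m : CVec (TangentSpace (𝓡 4) x)) : Prop where
  ll : g.inner x l l = 0
  nn : g.inner x n n = 0
  ln : g.inner x l n = 1
  lm : CVec.bilin (g.inner x) (CVec.ofReal l) m = 0
  nm : CVec.bilin (g.inner x) (CVec.ofReal n) m = 0
  mm : CVec.bilin (g.inner x) m m = 0
  mmbar : CVec.bilin (g.inner x) m m.conj = -1

/-- The field of real parts of a complex vector field. -/
def reField (m : Π x : M, CVec (TangentSpace (𝓡 4) x)) : Π x : M, TangentSpace (𝓡 4) x :=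
  fun x ↦ (m x).re

/-- The field of imaginary parts of a complex vector field. -/
def imField (m : Π x : M, CVec (TangentSpace (𝓡 4) x)) : Π x : M, TangentSpace (𝓡 4) x :=
  fun x ↦ (m x).im

/-- The derivative `u^a ∇_a m^b` of a complex vector field along a real vector `u` at `x`. -/
def covC (D : Connection M) (m : Π x : M, CVec (TangentSpace (𝓡 4) x)) (x : M)
    (u : TangentSpace (𝓡 4) x) : CVec (TangentSpace (𝓡 4) x) :=
  ⟨D (reField m) x u, D (imField m) x u⟩

/-- The Lie derivative `£_l m = [l, m]` of a complex vector field. -/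
def lieC (l : Π x : M, TangentSpace (𝓡 4) x) (m : Π x : M, CVec (TangentSpace (𝓡 4) x))
    (x : M) : CVec (TangentSpace (𝓡 4) x) :=
  ⟨VectorField.mlieBracket (𝓡 4) l (reField m) x, VectorField.mlieBracket (𝓡 4) l (imField m) x⟩

/-- The expansion `q^{ab} ∇_a l_b` of `l` at `x`, where `q^{ab} = - m^a m̄^b - m̄^a m^b`. -/
def expansion (g : LorentzMetric M) (D : Connection M) (l : Π x : M, TangentSpace (𝓡 4) x)
    (x : M) (m : CVec (TangentSpace (𝓡 4) x)) : ℂ :=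
  - CVec.bilin (g.inner x) (CVec.map (D l x) m) m.conj
    - CVec.bilin (g.inner x) (CVec.map (D l x) m.conj) m

/-- The spin coefficient `ε = (n^a l^b ∇_b l_a - m̄^a l^b ∇_b m_a) / 2` at `x`. -/
def spinEpsilon (g : LorentzMetric M) (D : Connection M) (l : Π x : M, TangentSpace (𝓡 4) x)
    (m : Π x : M, CVec (TangentSpace (𝓡 4) x)) (x : M) (n : TangentSpace (𝓡 4) x) : ℂ :=
  ((g.inner x n (D l x (l x)) : ℂ)
    - CVec.bilin (g.inner x) (m x).conj (covC D m x (l x))) / 2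

/-! ### Non-expanding horizons -/

/-- `u` is a null normal, at the point `ψ p`, to the hypersurface parametrized by `ψ`. -/
def IsNullNormalAt (g : LorentzMetric M) (ψ : ℝ × S2 → M) (p : ℝ × S2)
    (u : TangentSpace (𝓡 4) (ψ p)) : Prop :=
  u ≠ 0 ∧ g.inner (ψ p) u u = 0 ∧
    ∀ v, g.inner (ψ p) u (mfderiv (𝓘(ℝ, ℝ).prod (𝓡 2)) (𝓡 4) ψ p v) = 0

/-- `l` is a smooth null normal field on the hypersurface parametrized by `ψ`. As usual, fields
on the hypersurface are represented by extensions to `M` that are smooth near the hypersurface;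
away from it `l` is arbitrary. -/
def IsNullNormal (g : LorentzMetric M) (ψ : ℝ × S2 → M) (l : Π x : M, TangentSpace (𝓡 4) x) :
    Prop :=
  ∀ p, SmoothFieldAt l (ψ p) ∧ IsNullNormalAt g ψ p (l (ψ p))

/-- The image of `ψ` is a non-expanding horizon: an embedded null hypersurface with topology
`ℝ × S²`, all of whose null normals have vanishing expansion, on which Einstein's equations hold,
and such that `T^a_b l^b` is future pointing (or zero) for each future pointing null normal. -/
structure IsNonExpandingHorizon (g : LorentzMetric M) (τ : TimeOrientation g) (D : Connection M)
    (T : TwoTensor M) (ψ : ℝ × S2 → M) : Prop where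
  embedding : Manifold.IsSmoothEmbedding (𝓘(ℝ, ℝ).prod (𝓡 2)) (𝓡 4) ∞ ψ
  null : ∀ p, ∃ u, IsNullNormalAt g ψ p u
  nonexpanding : ∀ l, IsNullNormal g ψ l → ∀ p n m,
    IsNullTetrad g (ψ p) (l (ψ p)) n m → expansion g D l (ψ p) m = 0
  einstein : ∀ p, EinsteinAt g D T (ψ p)
  energy : ∀ p u, IsNullNormalAt g ψ p u → τ.FuturePointing u →
    ∀ w, (∀ v, g.inner (ψ p) w v = T (ψ p) v u) → w = 0 ∨ τ.FuturePointing w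

/-- `x` and `y` lie on the same orbit of `l` inside the set `H`. When `l` is a null normal to the
null hypersurface `H`, these orbits are the generators of `H`. -/
def SameGenerator (H : Set M) (l : Π x : M, TangentSpace (𝓡 4) x) (x y : M) : Prop :=
  ∃ (γ : ℝ → M) (a b : ℝ), γ a = x ∧ γ b = y ∧ IsMIntegralCurveOn γ l (Set.uIcc a b) ∧
    ∀ t ∈ Set.uIcc a b, γ t ∈ H

/-- `s` parametrizes a spherical cut of `H`: an embedded two-sphere in `H`, transversal to the
generators, which is met exactly once by every generator. -/
structure IsSphericalCut (H : Set M) (l : Π x : M, TangentSpace (𝓡 4) x) (s : S2 → M) : Prop where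
  embedding : Manifold.IsSmoothEmbedding (𝓡 2) (𝓡 4) ∞ s
  mem : ∀ p, s p ∈ H
  transversal : ∀ p v, mfderiv (𝓡 2) (𝓡 4) s p v ≠ l (s p)
  cross : ∀ x ∈ H, ∃! p : S2, SameGenerator H l (s p) x

/-- The part of `H` swept out by the generators through the piece `s '' W` of the cut `s`. -/
def sweptBy (H : Set M) (l : Π x : M, TangentSpace (𝓡 4) x) (s : S2 → M) (W : Set S2) : Set M :=
  {x | x ∈ H ∧ ∃ p ∈ W, SameGenerator H l (s p) x}

end Spacetime

end NEH

end

/-! ### Derivatives along extensions of tangent vectors that are constant in a chart -/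

namespace NEH
open Filter Topology Bundle

section Calculus

variable {E : Type*} [NormedAddCommGroup E] [NormedSpace ℝ E]
  {H : Type*} [TopologicalSpace H] {I : ModelWithCorners ℝ E H}
  {N : Type*} [TopologicalSpace N] [ChartedSpace H N]
  {F : Type*} [NormedAddCommGroup F] [NormedSpace ℝ F]

/-! Write `e`, `f` for the real and imaginary parts of `m` and `B(v,w) = g(∇_v l, w)`. Everything
follows from evolution equations along a single generator.

Orthogonality to `l`. Lie dragging and vanishing torsion give `∇_l e = ∇_e l`, so `g(l,e)` has
derivative `g(∇_l l, e) + g(l, ∇_e l)` along `l`. As a form in `e` this vanishes on `l^⊥`: there `B`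
is symmetric, and `g(l,l) = 0` on the horizon, so `∇_l l` is proportional to `l`. The form is thus a
multiple `K` of `g(l, ·)`. Hence `g(l,e)` solves a homogeneous linear equation and stays zero
(`IsNullNormal.inner_dragged_eq_zero`).

Products of `e` and `f`. Their derivatives are entries of `B`, so it must be shown that `B = 0` on
the plane of `e` and `f`. Zero expansion says that `B` is trace-free there. Differentiating the
trace along `l` gives the Raychaudhuri equation (`IsNonExpandingHorizon.mvfderiv_trace`), which
reduces to `2 det B = q Ric(l,l)` with `q > 0` the Gram determinant. Einstein's equations and the
energy condition make `Ric(l,l)` nonnegative (`IsNonExpandingHorizon.ricci_nonneg`). A symmetric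
trace-free form on a definite plane with nonnegative determinant is zero (`symm_form_eq_zero`), so
the Gram matrix is constant (`IsNonExpandingHorizon.inner_dragged_eq`).

Reality of `ε`. The imaginary part of `m̄·∇_l m = m̄·∇_m l` is the antisymmetric part of `B` on `e`,
`f`, which is zero. -/

theorem mvfderiv_congr {f f' : N → F} {x : N} (h : f =ᶠ[𝓝 x] f') :
    mvfderiv I f x = mvfderiv I f' x := by
  have := h.mfderiv_eq (I := I) (I' := 𝓘(ℝ, F))
  ext v
  exact congr($this v)

theorem mvfderiv_comp_fderiv {E' : Type*} [NormedAddCommGroup E'] [NormedSpace ℝ E']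
    {G : E' → F} {f : N → E'} {x : N} (hG : DifferentiableAt ℝ G (f x))
    (hf : MDifferentiableAt I 𝓘(ℝ, E') f x) (u : TangentSpace I x) :
    mvfderiv I (G ∘ f) x u = fderiv ℝ G (f x) (mvfderiv I f x u) := by
  have := congr($(mfderiv_comp x hG.mdifferentiableAt hf) u)
  rw [mfderiv_eq_fderiv] at this
  exact this

variable [IsManifold I ∞ N]

/-- The derivative of a chart sends the locally constant extension of `v` to a constant. -/
theorem mfderiv_extChartAt_extend {x y : N} (hy : y ∈ (chartAt H x).source)
    (v : TangentSpace I x) :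
    (mvfderiv I (extChartAt I x) y (FiberBundle.extend E v y) : E) =
      (trivializationAt E (TangentSpace I) x ⟨x, v⟩).2 := by
  have : IsManifold I 1 N := .of_le (n := ∞) (by simp)
  have h := TangentBundle.continuousLinearMapAt_trivializationAt (I := I) hy
  have : (mvfderiv I (extChartAt I x) y (FiberBundle.extend E v y) : E) =
      (trivializationAt E (TangentSpace I) x).continuousLinearMapAt ℝ y
        (FiberBundle.extend E v y) := by
    rw [h]; rfl
  rw [this, FiberBundle.extend]
  have hy' : y ∈ (trivializationAt E (TangentSpace I : N → Type _) x).baseSet := hy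
  have h3 := (trivializationAt E (TangentSpace I) x).continuousLinearMapAt_symmL (R := ℝ) hy'
    (trivializationAt E (TangentSpace I) x ⟨x, v⟩).2
  rwa [Trivialization.symmL_apply (R := ℝ) _ hy'] at h3

theorem mvfderiv_apply_extend [I.Boundaryless] {f : N → F} {x y : N} (hy : y ∈ (chartAt H x).source)
    (hf : MDifferentiableAt I 𝓘(ℝ, F) f y) (v : TangentSpace I x) :
    mvfderiv I f y (FiberBundle.extend E v y) =
      fderiv ℝ (f ∘ (extChartAt I x).symm) (extChartAt I x y)
        (trivializationAt E (TangentSpace I) x ⟨x, v⟩).2 := by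
  have : IsManifold I 1 N := .of_le (n := ∞) (by simp)
  have hy' : y ∈ (extChartAt I x).source := by simpa using hy
  have hφ : MDifferentiableAt I 𝓘(ℝ, E) (extChartAt I x) y := mdifferentiableAt_extChartAt hy
  have hsymm : MDifferentiableAt 𝓘(ℝ, E) I (extChartAt I x).symm (extChartAt I x y) := by
    have := mdifferentiableWithinAt_extChartAt_symm (I := I) ((extChartAt I x).map_source hy')
    rwa [I.range_eq_univ, mdifferentiableWithinAt_univ] at this
  have hfs : MDifferentiableAt 𝓘(ℝ, E) 𝓘(ℝ, F) (f ∘ (extChartAt I x).symm) (extChartAt I x y) := by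
    refine MDifferentiableAt.comp _ ?_ hsymm
    rwa [(extChartAt I x).left_inv hy']
  have hcongr : f =ᶠ[𝓝 y] (f ∘ (extChartAt I x).symm) ∘ extChartAt I x := by
    filter_upwards [extChartAt_source_mem_nhds' (I := I) hy'] with z hz
    simp only [Function.comp_apply, (extChartAt I x).left_inv hz]
  rw [mvfderiv_congr hcongr, mvfderiv_comp_fderiv hfs.differentiableAt hφ,
    mfderiv_extChartAt_extend hy]

/-- Second derivatives along locally constant extensions, in the chart. -/
theorem mvfderiv_mvfderiv_extend [I.Boundaryless] {f : N → F} {x : N} (hf : ContMDiffAt I 𝓘(ℝ, F) 2 f x)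
    (u v : TangentSpace I x) :
    mvfderiv I (fun y ↦ mvfderiv I f y (FiberBundle.extend E v y)) x u =
      fderiv ℝ (fderiv ℝ (f ∘ (extChartAt I x).symm)) (extChartAt I x x)
        (trivializationAt E (TangentSpace I) x ⟨x, u⟩).2
        (trivializationAt E (TangentSpace I) x ⟨x, v⟩).2 := by
  have : IsManifold I 1 N := .of_le (n := ∞) (by simp)
  have : IsManifold I 2 N := .of_le (n := ∞) (WithTop.coe_le_coe.2 le_top)
  have hf1 : ∀ᶠ y in 𝓝 x, ContMDiffAt I 𝓘(ℝ, F) 2 f y := (contMDiffAt_iff_contMDiffAt_nhds (by simp)).1 hf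
  set G : E → F := fun z ↦ fderiv ℝ (f ∘ (extChartAt I x).symm) z
        (trivializationAt E (TangentSpace I) x ⟨x, v⟩).2 with hG
  have hc : (fun y ↦ mvfderiv I f y (FiberBundle.extend E v y)) =ᶠ[𝓝 x]
      G ∘ extChartAt I x := by
    filter_upwards [hf1, (chartAt H x).open_source.mem_nhds (mem_chart_source H x)] with y hy hy'
    exact mvfderiv_apply_extend hy' (hy.mdifferentiableAt (by simp)) v
  have hfs : ContDiffAt ℝ 2 (f ∘ (extChartAt I x).symm) (extChartAt I x x) := by
    have := (contMDiffAt_iff.1 hf).2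
    rwa [I.range_eq_univ, contDiffWithinAt_univ] at this
  have hd : DifferentiableAt ℝ (fderiv ℝ (f ∘ (extChartAt I x).symm)) (extChartAt I x x) :=
    (hfs.fderiv_right (m := 1) (by norm_num)).differentiableAt (by simp)
  have hGd : DifferentiableAt ℝ G (extChartAt I x x) := hd.clm_apply (differentiableAt_const _)
  have hφ : MDifferentiableAt I 𝓘(ℝ, E) (extChartAt I x) x :=
    mdifferentiableAt_extChartAt (mem_chart_source H x)
  have h1 := mfderiv_extChartAt_extend (I := I) (mem_chart_source H x) u
  rw [FiberBundle.extend_apply_self] at h1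
  rw [mvfderiv_congr hc, mvfderiv_comp_fderiv hGd hφ, h1, hG,
    fderiv_clm_apply hd (differentiableAt_const _)]
  simp

/-- In the chart both sides are the second derivative of `f` in two fixed directions, so this is
Schwarz's theorem. -/
theorem mvfderiv_extend_comm [I.Boundaryless] {f : N → F} {x : N} (hf : ContMDiffAt I 𝓘(ℝ, F) 2 f x)
    (u v : TangentSpace I x) :
    mvfderiv I (fun y ↦ mvfderiv I f y (FiberBundle.extend E v y)) x u =
      mvfderiv I (fun y ↦ mvfderiv I f y (FiberBundle.extend E u y)) x v := by
  have hfs : ContDiffAt ℝ 2 (f ∘ (extChartAt I x).symm) (extChartAt I x x) := by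
    have := (contMDiffAt_iff.1 hf).2
    rwa [I.range_eq_univ, contDiffWithinAt_univ] at this
  rw [mvfderiv_mvfderiv_extend hf, mvfderiv_mvfderiv_extend hf]
  exact (hfs.isSymmSndFDerivAt (by simp)).eq _ _

/-- Pulled back to the chart, both fields are constant near the point, and constant fields commute.
-/
theorem mlieBracket_extend [I.Boundaryless] [CompleteSpace E] (x : N) (u v : TangentSpace I x) :
    VectorField.mlieBracket I (FiberBundle.extend E u) (FiberBundle.extend E v) x = 0 := by
  have : IsManifold I 1 N := .of_le (n := ∞) (by simp)
  have key : ∀ w : TangentSpace I x, VectorField.mpullbackWithin 𝓘(ℝ, E) I (extChartAt I x).symm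
      (FiberBundle.extend E w) (Set.range I) =ᶠ[𝓝 (extChartAt I x x)]
      fun _ ↦ (trivializationAt E (TangentSpace I) x ⟨x, w⟩).2 := by
    intro w
    filter_upwards [extChartAt_target_mem_nhds (I := I) x] with z hz
    have hzs := (extChartAt I x).map_target hz
    rw [VectorField.mpullbackWithin_apply]
    rw [← mfderiv_extChartAt_extend (I := I) (y := (extChartAt I x).symm z) (by simpa using hzs) w]
    have := mfderiv_extChartAt_comp_mfderivWithin_extChartAt_symm (I := I) hz
    have h2 := mfderivWithin_extChartAt_symm_comp_mfderiv_extChartAt (I := I) hz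
    rw [ContinuousLinearMap.inverse_eq h2 this]
    rfl
  have hu := key u
  have hv := key v
  have aux : ∀ (U V : E → E) (a b : E) (z : E), (U =ᶠ[𝓝 z] fun _ ↦ a) → (V =ᶠ[𝓝 z] fun _ ↦ b) →
      VectorField.lieBracketWithin ℝ U V Set.univ z = 0 := by
    intro U V a b z hU hV
    rw [VectorField.lieBracketWithin_univ, Filter.EventuallyEq.lieBracket_vectorField_eq hU hV]
    simp [VectorField.lieBracket]
  rw [← VectorField.mlieBracketWithin_univ, VectorField.mlieBracketWithin_apply]
  have hs : (extChartAt I x).symm ⁻¹' Set.univ ∩ Set.range I = Set.univ := by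
    simp [I.range_eq_univ]
  rw [hs]
  erw [aux _ _ _ _ _ hu hv]
  exact map_zero _

end Calculus
end NEH

/-! ### Smoothness of directional derivatives, immersions, local frames -/

namespace NEH
open Filter Topology Bundle

section Calculus2

variable {E : Type*} [NormedAddCommGroup E] [NormedSpace ℝ E]
  {H : Type*} [TopologicalSpace H] {I : ModelWithCorners ℝ E H}
  {N : Type*} [TopologicalSpace N] [ChartedSpace H N] [IsManifold I ∞ N]
  {F : Type*} [NormedAddCommGroup F] [NormedSpace ℝ F]

/-- The derivative of a smooth function along a smooth vector field is smooth. -/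
theorem contMDiffAt_mvfderiv_apply {f : N → F} {X : Π x : N, TangentSpace I x} {x : N}
    (hf : ContMDiffAt I 𝓘(ℝ, F) ∞ f x)
    (hX : ContMDiffAt I (I.prod 𝓘(ℝ, E)) ∞ (fun y ↦ (⟨y, X y⟩ : TangentBundle I N)) x) :
    ContMDiffAt I 𝓘(ℝ, F) ∞ (fun y ↦ mvfderiv I f y (X y)) x := by
  have : IsManifold I 1 N := .of_le (n := ∞) (by simp)
  have h1 := hf.mfderiv_const (m := ∞) (by simp)
  have h2 := ContMDiffAt.clm_apply_of_inCoordinates (F₁ := E) (F₂ := F)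
    (E₁ := fun x : N ↦ TangentSpace I x) (E₂ := fun y : F ↦ TangentSpace 𝓘(ℝ, F) y)
    (b₁ := id) (b₂ := f) (v := X) (ϕ := fun m ↦ mfderiv I 𝓘(ℝ, F) f m) h1 hX hf
  exact (contMDiff_snd_tangentBundle_modelSpace (I := 𝓘(ℝ, F)) (n := ∞) F _).comp x h2

omit [IsManifold I ∞ N] in
-- In suitable charts an immersion is `u ↦ (u, 0)`. Projecting to the first factor therefore gives a
-- differentiable local left inverse, and the chain rule a left inverse of the derivative.
theorem mfderiv_injective_of_isImmersionAt {E' : Type*} [NormedAddCommGroup E'] [NormedSpace ℝ E']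
    {H' : Type*} [TopologicalSpace H'] {J : ModelWithCorners ℝ E' H'}
    {M : Type*} [TopologicalSpace M] [ChartedSpace H' M] [IsManifold J ∞ M]
    [I.Boundaryless] {ψ : N → M} {p : N}
    (h : Manifold.IsImmersionAt I J ∞ ψ p) :
    Function.Injective (mfderiv I J ψ p) := by
  have hp := h.mem_domChart_source
  have hT : (h.domChart.extend I).symm ((h.domChart.extend I) p) = p :=
    h.domChart.extend_left_inv hp
  have hopen : I '' h.domChart.target ∈ 𝓝 ((h.domChart.extend I) p) := by
    rw [I.image_eq]
    have := h.domChart.extend_target_mem_nhdsWithin (I := I) hp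
    rwa [I.range_eq_univ, nhdsWithin_univ, h.domChart.extend_target] at this
  have d1 : MDifferentiableAt 𝓘(ℝ, E) I (h.domChart.extend I).symm ((h.domChart.extend I) p) :=
    ((contMDiffOn_extend_symm h.domChart_mem_maximalAtlas).contMDiffAt hopen).mdifferentiableAt
      (by simp)
  have d2 : MDifferentiableAt J 𝓘(ℝ, E') (h.codChart.extend J) (ψ p) :=
    (h.codChart.contMDiffAt_extend h.codChart_mem_maximalAtlas
      h.mem_codChart_source).mdifferentiableAt (by simp)
  have d3 : MDifferentiableAt I J ψ p := h.contMDiffAt.mdifferentiableAt (by simp)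
  have heq : ∀ q ∈ h.domChart.source,
      (h.equiv.symm ((h.codChart.extend J) (ψ q))).1 = (h.domChart.extend I) q := by
    intro q hq
    have := h.writtenInCharts ((h.domChart.extend I).map_source (by simpa using hq))
    simp only [Function.comp_apply, h.domChart.extend_left_inv hq] at this
    rw [this]
    simp
  let pr : E' →L[ℝ] E := (ContinuousLinearMap.fst ℝ E h.complement).comp
    (h.equiv.symm : E' →L[ℝ] E × h.complement)
  have d4 : MDifferentiableAt 𝓘(ℝ, E') 𝓘(ℝ, E) pr ((h.codChart.extend J) (ψ p)) :=
    pr.differentiableAt.mdifferentiableAt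
  have d5 : MDifferentiableAt I 𝓘(ℝ, E) (pr ∘ (h.codChart.extend J) ∘ ψ) p :=
    d4.comp p (d2.comp p d3)
  have hpp : (pr ∘ (h.codChart.extend J) ∘ ψ) p = (h.domChart.extend I) p := heq p hp
  have d1' : MDifferentiableAt 𝓘(ℝ, E) I (h.domChart.extend I).symm
      ((pr ∘ (h.codChart.extend J) ∘ ψ) p) := by rwa [hpp]
  have hid : (h.domChart.extend I).symm ∘ (pr ∘ (h.codChart.extend J) ∘ ψ) =ᶠ[𝓝 p] id := by
    filter_upwards [h.domChart.open_source.mem_nhds hp] with q hq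
    have : (pr ∘ (h.codChart.extend J) ∘ ψ) q = (h.domChart.extend I) q := heq q hq
    simp only [Function.comp_apply] at this
    simp only [Function.comp_apply, id, this, h.domChart.extend_left_inv hq]
  have e1 := hid.mfderiv_eq (I := I) (I' := I)
  rw [mfderiv_comp p d1' d5, mfderiv_comp p d4 (d2.comp p d3), mfderiv_comp p d2 d3, mfderiv_id] at e1
  intro u v huv
  have eu := congr($e1 u)
  have ev := congr($e1 v)
  simp only [ContinuousLinearMap.comp_apply] at eu ev
  rw [huv] at eu
  exact eu.symm.trans ev

/-- A smooth vector field is locally a combination of constant extensions. -/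
theorem exists_eventually_eq_sum_extend {ι : Type*} [Fintype ι] [FiniteDimensional ℝ E] {x : N}
    (b : Module.Basis ι ℝ (TangentSpace I x)) {X : Π x : N, TangentSpace I x}
    (hX : ContMDiffAt I (I.prod 𝓘(ℝ, E)) ∞ (fun y ↦ (⟨y, X y⟩ : TangentBundle I N)) x) :
    ∃ f : ι → N → ℝ, (∀ i, ContMDiffAt I 𝓘(ℝ, ℝ) ∞ (f i) x) ∧
      ∀ᶠ y in 𝓝 x, X y = ∑ i, f i y • FiberBundle.extend E (b i) y := by
  have : IsManifold I 1 N := .of_le (n := ∞) (by simp)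
  let t := trivializationAt E (TangentSpace I : N → Type _) x
  have hxt : x ∈ t.baseSet := FiberBundle.mem_baseSet_trivializationAt' x
  let L := t.continuousLinearEquivAt ℝ x hxt
  let c : Module.Basis ι ℝ E := b.map L.toLinearEquiv
  have hc : ∀ i, c i = (t ⟨x, b i⟩).2 := by
    intro i
    simp [c, L]
  refine ⟨fun i y ↦ c.repr (t ⟨y, X y⟩).2 i, fun i ↦ ?_, ?_⟩
  · have h1 := (contMDiffAt_section x).1 hX
    have h2 : ContDiff ℝ ∞ (fun v : E ↦ c.repr v i) :=
      (LinearMap.toContinuousLinearMap (c.coord i)).contDiff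
    exact h2.contDiffAt.contMDiffAt.comp x h1
  · filter_upwards [t.open_baseSet.mem_nhds hxt] with y hy
    have h1 := c.sum_repr (t ⟨y, X y⟩).2
    have h2 := congrArg (t.symmL ℝ y) h1
    have h3 : t.symmL ℝ y (t ⟨y, X y⟩).2 = X y := by
      have := Trivialization.symmL_continuousLinearMapAt (R := ℝ) t hy (X y)
      rwa [Trivialization.continuousLinearMapAt_apply, Trivialization.linearMapAt_apply, if_pos hy] at this
    rw [h3, map_sum] at h2
    refine h2.symm.trans ?_
    refine Finset.sum_congr rfl fun i _ ↦ ?_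
    rw [map_smul, hc, Trivialization.symmL_apply (R := ℝ) t hy]
    rfl

end Calculus2
end NEH

/-! ### Smooth vector fields and the calculus of the connection -/

namespace NEH
open Filter Topology Bundle

section Fields

variable {M : Type*} [TopologicalSpace M] [ChartedSpace E4 M] [IsManifold (𝓡 4) ∞ M]

/-- A vector field on space-time. -/
abbrev VField (M : Type*) [TopologicalSpace M] [ChartedSpace E4 M] : Type _ :=
  Π x : M, TangentSpace (𝓡 4) x

/-- A real function, smooth at `x`. -/
abbrev SmoothFunAt (f : M → ℝ) (x : M) : Prop := ContMDiffAt (𝓡 4) 𝓘(ℝ, ℝ) ∞ f x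

variable {X Y Z : VField M} {f h : M → ℝ} {x : M}

theorem SmoothFieldAt.add (hX : SmoothFieldAt X x) (hY : SmoothFieldAt Y x) :
    SmoothFieldAt (X + Y) x := ContMDiffAt.add_section hX hY

theorem SmoothFieldAt.smul (hf : SmoothFunAt f x) (hX : SmoothFieldAt X x) :
    SmoothFieldAt (f • X) x := ContMDiffAt.smul_section hf hX

theorem SmoothFieldAt.sum {ι : Type*} {s : Finset ι} {X : ι → VField M}
    (hX : ∀ i ∈ s, SmoothFieldAt (X i) x) : SmoothFieldAt (fun y ↦ ∑ i ∈ s, X i y) x :=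
  ContMDiffAt.sum_section hX

theorem SmoothFieldAt.congr (hX : SmoothFieldAt X x) (h : ∀ᶠ y in 𝓝 x, Y y = X y) :
    SmoothFieldAt Y x := by
  refine ContMDiffAt.congr_of_eventuallyEq hX ?_
  filter_upwards [h] with y hy
  rw [hy]

theorem SmoothFieldAt.diffFieldAt (hX : SmoothFieldAt X x) : DiffFieldAt X x :=
  ContMDiffAt.mdifferentiableAt hX (by simp)

omit [IsManifold (𝓡 4) ∞ M] in
theorem SmoothFunAt.mdifferentiableAt (hf : SmoothFunAt f x) :
    MDifferentiableAt (𝓡 4) 𝓘(ℝ, ℝ) f x := ContMDiffAt.mdifferentiableAt hf (by simp)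

theorem SmoothFieldAt.eventually_diffFieldAt (hX : SmoothFieldAt X x) :
    ∀ᶠ y in 𝓝 x, DiffFieldAt X y := by
  have h1 : ContMDiffAt (𝓡 4) ((𝓡 4).prod 𝓘(ℝ, E4)) 1
    (fun y ↦ (⟨y, X y⟩ : TangentBundle (𝓡 4) M)) x := ContMDiffAt.of_le hX (by simp)
  have : IsManifold (𝓡 4) 1 M := .of_le (n := ∞) (by simp)
  have : IsManifold ((𝓡 4).prod 𝓘(ℝ, E4)) 1 (TangentBundle (𝓡 4) M) := inferInstance
  filter_upwards [(contMDiffAt_iff_contMDiffAt_nhds (by simp)).1 h1] with y hy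
  exact hy.mdifferentiableAt (by simp)

theorem SmoothFunAt.eventually_mdifferentiableAt (hf : SmoothFunAt f x) :
    ∀ᶠ y in 𝓝 x, MDifferentiableAt (𝓡 4) 𝓘(ℝ, ℝ) f y := by
  have h1 : ContMDiffAt (𝓡 4) 𝓘(ℝ, ℝ) 1 f x := ContMDiffAt.of_le hf (by simp)
  have : IsManifold (𝓡 4) 1 M := .of_le (n := ∞) (by simp)
  filter_upwards [(contMDiffAt_iff_contMDiffAt_nhds (by simp)).1 h1] with y hy
  exact hy.mdifferentiableAt (by simp)

theorem smoothFieldAt_extend (v : TangentSpace (𝓡 4) x) :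
    SmoothFieldAt (FiberBundle.extend E4 v) x :=
  FiberBundle.contMDiffAt_extend (𝓡 4) E4 v

theorem SmoothFunAt.mvfderiv_apply (hf : SmoothFunAt f x) (hX : SmoothFieldAt X x) :
    SmoothFunAt (fun y ↦ mvfderiv (𝓡 4) f y (X y)) x :=
  contMDiffAt_mvfderiv_apply hf hX

theorem LorentzMetric.smoothFunAt_inner (g : LorentzMetric M) (hX : SmoothFieldAt X x)
    (hY : SmoothFieldAt Y x) : SmoothFunAt (fun y ↦ g.inner y (X y) (Y y)) x := by
  have h := ContMDiffAt.clm_bundle_apply₂ (F₁ := E4) (F₂ := E4) (F₃ := ℝ)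
    (E₁ := fun x : M ↦ TangentSpace (𝓡 4) x) (E₂ := fun x : M ↦ TangentSpace (𝓡 4) x)
    (E₃ := Bundle.Trivial M ℝ)
    (b := id) (n := ∞) (ψ := fun y ↦ g.inner y) (v := X) (w := Y) (x := x)
    (g.contMDiff x) hX hY
  exact (contMDiffAt_totalSpace.1 h).2

/-! ### The connection -/

variable (D : Connection M)

theorem conn_congr (hX : DiffFieldAt X x) (hY : DiffFieldAt Y x) (h : ∀ᶠ y in 𝓝 x, X y = Y y) :
    D X x = D Y x :=
  D.isCovariantDerivativeOnUniv.congr_of_eventuallyEq hX hY univ_mem h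

theorem conn_add (hX : DiffFieldAt X x) (hY : DiffFieldAt Y x) :
    D (X + Y) x = D X x + D Y x :=
  D.isCovariantDerivativeOnUniv.add hX hY

theorem conn_smul (hf : MDifferentiableAt (𝓡 4) 𝓘(ℝ, ℝ) f x) (hX : DiffFieldAt X x)
    (u : TangentSpace (𝓡 4) x) :
    D (f • X) x u = f x • D X x u + mvfderiv (𝓡 4) f x u • X x := by
  rw [D.isCovariantDerivativeOnUniv.leibniz hX hf]
  rfl

theorem DiffFieldAt.smul (hf : MDifferentiableAt (𝓡 4) 𝓘(ℝ, ℝ) f x) (hX : DiffFieldAt X x) :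
    DiffFieldAt (f • X) x := MDifferentiableAt.smul_section hf hX

theorem DiffFieldAt.add (hX : DiffFieldAt X x) (hY : DiffFieldAt Y x) :
    DiffFieldAt (X + Y) x := mdifferentiableAt_add_section hX hY

theorem DiffFieldAt.sum {ι : Type*} {s : Finset ι} {X : ι → VField M}
    (hX : ∀ i ∈ s, DiffFieldAt (X i) x) : DiffFieldAt (∑ i ∈ s, X i) x := by
  classical
  induction s using Finset.induction_on with
  | empty => simpa using! mdifferentiableAt_zeroSection ..
  | insert i s hi ih =>
    rw [Finset.sum_insert hi]
    exact (hX i (by simp)).add (ih fun j hj ↦ hX j (by simp [hj]))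

theorem conn_sum {ι : Type*} {s : Finset ι} {X : ι → VField M}
    (hX : ∀ i ∈ s, DiffFieldAt (X i) x) : D (∑ i ∈ s, X i) x = ∑ i ∈ s, D (X i) x := by
  classical
  induction s using Finset.induction_on with
  | empty => simp
  | insert i s hi ih =>
    rw [Finset.sum_insert hi, Finset.sum_insert hi,
      conn_add D (hX i (by simp)) (DiffFieldAt.sum fun j hj ↦ hX j (by simp [hj])),
      ih fun j hj ↦ hX j (by simp [hj])]

/-- A locally constant extension agrees near the point with a globally smooth field. -/
theorem exists_global_extend [T2Space M] (v : TangentSpace (𝓡 4) x) :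
    ∃ G : VField M, (∀ y, SmoothFieldAt G y) ∧ ∀ᶠ y in 𝓝 x, FiberBundle.extend E4 v y = G y := by
  obtain ⟨s, hs, hsm⟩ := FiberBundle.exists_contMDiffOn_extend (k := ∞) (𝓡 4) E4 v
  obtain ⟨χ, -, hχ⟩ := (SmoothBumpFunction.nhds_basis_tsupport (I := 𝓡 4) x).mem_iff.1
    (interior_mem_nhds.2 hs)
  refine ⟨(χ : M → ℝ) • FiberBundle.extend E4 v, fun y ↦ ?_, ?_⟩
  · exact ContMDiffOn.smul_section_of_tsupport (χ.contMDiff.contMDiffOn) isOpen_interior hχ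
      (hsm.mono interior_subset) y
  · filter_upwards [χ.eventuallyEq_one] with y hy
    simp [hy]

/-- The smoothness of the connection is applied to fields that are smooth everywhere, whereas `Z` is
smooth only at `x`. So `Z` is expanded near `x` in globally smooth fields with smooth coefficients,
and the Leibniz rule does the rest. -/
theorem IsLeviCivita.smoothFieldAt_conn [T2Space M] {g : LorentzMetric M} {D : Connection M}
    (hD : IsLeviCivita g D) (hZ : SmoothFieldAt Z x) (hX : SmoothFieldAt X x) :
    SmoothFieldAt (fun y ↦ D Z y (X y)) x := by
  let b : Module.Basis (Fin 4) ℝ (TangentSpace (𝓡 4) x) := coordBasis x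
  obtain ⟨f, hf, hsum⟩ := exists_eventually_eq_sum_extend b hZ
  choose G hG hGe using fun i ↦ exists_global_extend (b i)
  have hsum' : ∀ᶠ y in 𝓝 x, Z y = (∑ i, f i • G i) y := by
    filter_upwards [hsum, eventually_all.2 hGe] with y hy hy'
    rw [hy]
    simp [hy']
  have hfd : ∀ᶠ y in 𝓝 x, ∀ i, MDifferentiableAt (𝓡 4) 𝓘(ℝ, ℝ) (f i) y :=
    eventually_all.2 fun i ↦ SmoothFunAt.eventually_mdifferentiableAt (hf i)
  have hexp : ∀ᶠ y in 𝓝 x, D Z y (X y) =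
      ∑ i, ((f i • fun y ↦ D (G i) y (X y)) + (fun y ↦ mvfderiv (𝓡 4) (f i) y (X y)) • G i) y := by
    filter_upwards [hsum'.eventually_nhds, hfd, hZ.eventually_diffFieldAt] with y hy hfy hZy
    have hd : ∀ i ∈ Finset.univ, DiffFieldAt (f i • G i) y := fun i _ ↦
      DiffFieldAt.smul (hfy i) (hG i y).diffFieldAt
    rw [conn_congr D hZy (DiffFieldAt.sum hd) hy, conn_sum D hd, _root_.sum_apply]
    refine Finset.sum_congr rfl fun i _ ↦ ?_
    rw [conn_smul D (hfy i) (hG i y).diffFieldAt]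
    rfl
  refine SmoothFieldAt.congr (SmoothFieldAt.sum fun i _ ↦ ?_) hexp
  refine SmoothFieldAt.add (SmoothFieldAt.smul (hf i) ?_)
    (SmoothFieldAt.smul (SmoothFunAt.mvfderiv_apply (hf i) hX) (hG i x))
  have h1 := hD.smooth.contMDiff.contMDiff (σ := G i) (fun y _ ↦ (hG i y).contMDiffWithinAt)
  have h2 := (h1 x (Set.mem_univ x)).contMDiffAt univ_mem
  exact ContMDiffAt.clm_bundle_apply h2 hX

end Fields
end NEH

/-! ### Tensoriality and symmetries of the curvature -/

namespace NEH
open Filter Topology Bundle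

section Curvature

variable {M : Type*} [TopologicalSpace M] [ChartedSpace E4 M] [IsManifold (𝓡 4) ∞ M]
  {X X' Y Y' Z Z' : VField M} {f h : M → ℝ} {x : M}

/-- An operation on smooth vector fields which is additive and linear over smooth functions depends
only on the value of the field at the point. -/
theorem eq_of_smooth_tensorial {W : Type*} [AddCommGroup W] [Module ℝ W] (Φ : VField M → W)
    (hadd : ∀ X Y, SmoothFieldAt X x → SmoothFieldAt Y x → Φ (X + Y) = Φ X + Φ Y)
    (hsmul : ∀ (f : M → ℝ) X, SmoothFunAt f x → SmoothFieldAt X x → Φ (f • X) = f x • Φ X)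
    (hX : SmoothFieldAt X x) (hY : SmoothFieldAt Y x) (h : X x = Y x) : Φ X = Φ Y := by
  classical
  have hlocal : ∀ X Y, SmoothFieldAt X x → SmoothFieldAt Y x → (∀ᶠ y in 𝓝 x, X y = Y y) →
      Φ X = Φ Y := by
    intro X Y hX hY hXY
    -- This indicator is locally constant near `x`, hence smooth at `x`, and `χ • X = χ • Y` holds
    -- globally. Smoothness elsewhere is not required, so no bump function is needed.
    let χ : M → ℝ := fun y ↦ if X y = Y y then 1 else 0
    have hχ : SmoothFunAt χ x := by
      refine (contMDiffAt_const (c := (1 : ℝ))).congr_of_eventuallyEq ?_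
      filter_upwards [hXY] with y hy
      simp [χ, hy]
    have hχx : χ x = 1 := by simp [χ, hXY.self_of_nhds]
    have h1 : χ • X = χ • Y := by
      funext y
      by_cases hy : X y = Y y <;> simp [χ, hy]
    have h2 := hsmul χ X hχ hX
    have h3 := hsmul χ Y hχ hY
    rw [hχx, one_smul] at h2 h3
    rw [← h2, ← h3, h1]
  have hzero : Φ 0 = 0 := by
    have := hsmul (fun _ ↦ 0) X contMDiffAt_const hX
    rw [zero_smul] at this
    rw [← this]
    congr 1
    funext y
    simp
  have hsum : ∀ (s : Finset (Fin 4)) (V : Fin 4 → VField M), (∀ i, SmoothFieldAt (V i) x) →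
      Φ (fun y ↦ ∑ i ∈ s, V i y) = ∑ i ∈ s, Φ (V i) := by
    intro s V hV
    induction s using Finset.induction_on with
    | empty =>
      simp only [Finset.sum_empty]
      exact hzero
    | insert i s hi ih =>
      rw [Finset.sum_insert hi, ← ih, ← hadd _ _ (hV i) (SmoothFieldAt.sum fun j _ ↦ hV j)]
      congr 1
      funext y
      rw [Finset.sum_insert hi]
      rfl
  have hexp : ∀ X, SmoothFieldAt X x → Φ X = ∑ i, (coordBasis x).repr (X x) i •
      Φ (FiberBundle.extend E4 (coordBasis x i)) := by
    intro X hX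
    obtain ⟨f, hf, hsumf⟩ := exists_eventually_eq_sum_extend (coordBasis x) hX
    have hs : ∀ i, SmoothFieldAt (f i • FiberBundle.extend E4 (coordBasis x i)) x := fun i ↦
      SmoothFieldAt.smul (hf i) (smoothFieldAt_extend _)
    have hXx : X x = ∑ i, f i x • coordBasis x i := by
      simpa using hsumf.self_of_nhds
    rw [hlocal X _ hX (SmoothFieldAt.sum fun i _ ↦ hs i) hsumf, hsum _ _ hs]
    refine Finset.sum_congr rfl fun i _ ↦ ?_
    rw [hsmul _ _ (hf i) (smoothFieldAt_extend _), hXx, Module.Basis.repr_sum_self]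
  rw [hexp X hX, hexp Y hY, h]

theorem curvatureField_swap (D : Connection M) :
    curvatureField D X Y Z x = - curvatureField D Y X Z x := by
  rw [curvatureField, curvatureField, VectorField.mlieBracket_swap_apply, map_neg]
  abel

variable [T2Space M] {g : LorentzMetric M} {D : Connection M} (hD : IsLeviCivita g D)
include hD

theorem curvatureField_add_left (hX : SmoothFieldAt X x) (hX' : SmoothFieldAt X' x)
    (hZ : SmoothFieldAt Z x) :
    curvatureField D (X + X') Y Z x = curvatureField D X Y Z x + curvatureField D X' Y Z x := by
  have h1 : (fun y ↦ D Z y ((X + X') y)) = (fun y ↦ D Z y (X y)) + fun y ↦ D Z y (X' y) := by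
    funext y
    simp
  have : IsManifold (𝓡 4) 1 M := .of_le (n := ∞) (by simp)
  rw [curvatureField, h1, conn_add D (hD.smoothFieldAt_conn hZ hX).diffFieldAt
    (hD.smoothFieldAt_conn hZ hX').diffFieldAt,
    VectorField.mlieBracket_add_left hX.diffFieldAt hX'.diffFieldAt]
  simp only [Pi.add_apply, map_add, _root_.add_apply, curvatureField]
  abel

theorem curvatureField_smul_left (hf : SmoothFunAt f x) (hX : SmoothFieldAt X x)
    (hZ : SmoothFieldAt Z x) :
    curvatureField D (f • X) Y Z x = f x • curvatureField D X Y Z x := by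
  have h1 : (fun y ↦ D Z y ((f • X) y)) = f • fun y ↦ D Z y (X y) := by
    funext y
    simp
  have : IsManifold (𝓡 4) 1 M := .of_le (n := ∞) (by simp)
  rw [curvatureField, h1, conn_smul D hf.mdifferentiableAt
    (hD.smoothFieldAt_conn hZ hX).diffFieldAt,
    VectorField.mlieBracket_smul_left hf.mdifferentiableAt hX.diffFieldAt]
  simp only [Pi.smul_apply', map_add, map_smul, curvatureField]
  module

theorem curvatureField_extend_add (u v : TangentSpace (𝓡 4) x) (hZ : SmoothFieldAt Z x)
    (hZ' : SmoothFieldAt Z' x) :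
    curvatureField D (FiberBundle.extend E4 u) (FiberBundle.extend E4 v) (Z + Z') x =
      curvatureField D (FiberBundle.extend E4 u) (FiberBundle.extend E4 v) Z x +
      curvatureField D (FiberBundle.extend E4 u) (FiberBundle.extend E4 v) Z' x := by
  have key : ∀ w : TangentSpace (𝓡 4) x,
      D (fun y ↦ D (Z + Z') y (FiberBundle.extend E4 w y)) x =
        D (fun y ↦ D Z y (FiberBundle.extend E4 w y)) x +
        D (fun y ↦ D Z' y (FiberBundle.extend E4 w y)) x := by
    intro w
    have hw := smoothFieldAt_extend w
    rw [← conn_add D (hD.smoothFieldAt_conn hZ hw).diffFieldAt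
      (hD.smoothFieldAt_conn hZ' hw).diffFieldAt]
    refine conn_congr D (hD.smoothFieldAt_conn (hZ.add hZ') hw).diffFieldAt
      ((hD.smoothFieldAt_conn hZ hw).add (hD.smoothFieldAt_conn hZ' hw)).diffFieldAt ?_
    filter_upwards [hZ.eventually_diffFieldAt, hZ'.eventually_diffFieldAt] with y h1 h2
    rw [conn_add D h1 h2]
    rfl
  simp only [curvatureField, key, conn_add D hZ.diffFieldAt hZ'.diffFieldAt,
    _root_.add_apply]
  abel

/-- The terms with one derivative of `f` cancel on exchanging `u` and `v`. Those with two
derivatives cancel because chart-constant extensions commute. -/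
theorem curvatureField_extend_smul (u v : TangentSpace (𝓡 4) x) (hf : SmoothFunAt f x)
    (hZ : SmoothFieldAt Z x) :
    curvatureField D (FiberBundle.extend E4 u) (FiberBundle.extend E4 v) (f • Z) x =
      f x • curvatureField D (FiberBundle.extend E4 u) (FiberBundle.extend E4 v) Z x := by
  have key : ∀ w z : TangentSpace (𝓡 4) x,
      D (fun y ↦ D (f • Z) y (FiberBundle.extend E4 w y)) x z =
        f x • D (fun y ↦ D Z y (FiberBundle.extend E4 w y)) x z + mvfderiv (𝓡 4) f x z • D Z x w +
        (mvfderiv (𝓡 4) f x w • D Z x z +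
          mvfderiv (𝓡 4) (fun y ↦ mvfderiv (𝓡 4) f y (FiberBundle.extend E4 w y)) x z • Z x) := by
    intro w z
    have hw := smoothFieldAt_extend w
    have h1 := hD.smoothFieldAt_conn hZ hw
    have h2 := SmoothFunAt.mvfderiv_apply hf hw
    have hc : D (fun y ↦ D (f • Z) y (FiberBundle.extend E4 w y)) x =
        D ((f • fun y ↦ D Z y (FiberBundle.extend E4 w y)) +
          (fun y ↦ mvfderiv (𝓡 4) f y (FiberBundle.extend E4 w y)) • Z) x := by
      refine conn_congr D (hD.smoothFieldAt_conn (hZ.smul hf) hw).diffFieldAt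
        ((h1.smul hf).add (hZ.smul h2)).diffFieldAt ?_
      filter_upwards [hf.eventually_mdifferentiableAt, hZ.eventually_diffFieldAt] with y h3 h4
      rw [conn_smul D h3 h4]
      rfl
    rw [hc, conn_add D (h1.smul hf).diffFieldAt (hZ.smul h2).diffFieldAt,
      _root_.add_apply, conn_smul D hf.mdifferentiableAt h1.diffFieldAt,
      conn_smul D h2.mdifferentiableAt hZ.diffFieldAt]
    simp
  have hcomm := mvfderiv_extend_comm (ContMDiffAt.of_le hf (WithTop.coe_le_coe.2 le_top)) u v
  simp only [curvatureField, key, mlieBracket_extend, map_zero, FiberBundle.extend_apply_self,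
    hcomm]
  module

/-- The Riemann tensor can be computed with any smooth extensions of the vectors. -/
theorem riemann_eq_curvatureField (hX : SmoothFieldAt X x) (hY : SmoothFieldAt Y x)
    (hZ : SmoothFieldAt Z x) :
    riemann D x (X x) (Y x) (Z x) = curvatureField D X Y Z x := by
  have h1 : riemann D x (X x) (Y x) (Z x) = curvatureField D (FiberBundle.extend E4 (X x))
      (FiberBundle.extend E4 (Y x)) Z x :=
    eq_of_smooth_tensorial (fun Z ↦ curvatureField D (FiberBundle.extend E4 (X x))
      (FiberBundle.extend E4 (Y x)) Z x)
      (fun _ _ h h' ↦ curvatureField_extend_add hD _ _ h h')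
      (fun _ _ h h' ↦ curvatureField_extend_smul hD _ _ h h') (smoothFieldAt_extend _) hZ (by simp)
  have left : ∀ X X' Y, SmoothFieldAt X x → SmoothFieldAt X' x → X x = X' x →
      curvatureField D X Y Z x = curvatureField D X' Y Z x := fun X X' Y h1 h2 h4 ↦
    eq_of_smooth_tensorial (fun X ↦ curvatureField D X Y Z x)
      (fun _ _ h h' ↦ curvatureField_add_left hD h h' hZ)
      (fun _ _ h h' ↦ curvatureField_smul_left hD h h' hZ) h1 h2 h4
  -- Tensoriality in the second slot comes from the first slot by antisymmetry.
  rw [h1, left _ X _ (smoothFieldAt_extend _) hX (by simp),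
    curvatureField_swap, left _ Y _ (smoothFieldAt_extend _) hY (by simp), ← curvatureField_swap]

/-- The endomorphism `u ↦ R(u, v) w`. -/
noncomputable def riemannEnd (x : M) (v w : TangentSpace (𝓡 4) x) :
    TangentSpace (𝓡 4) x →ₗ[ℝ] TangentSpace (𝓡 4) x where
  toFun u := riemann D x u v w
  map_add' u u' := by
    have hv := smoothFieldAt_extend v
    have hw := smoothFieldAt_extend w
    have hu := smoothFieldAt_extend u
    have hu' := smoothFieldAt_extend u'
    have h := riemann_eq_curvatureField hD (hu.add hu') hv hw
    rw [curvatureField_add_left hD hu hu' hw] at h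
    simpa [riemann] using h
  map_smul' c u := by
    have hv := smoothFieldAt_extend v
    have hw := smoothFieldAt_extend w
    have hu := smoothFieldAt_extend u
    have hc : SmoothFunAt (fun _ ↦ c) x := contMDiffAt_const
    have h := riemann_eq_curvatureField hD (hu.smul hc) hv hw
    rw [curvatureField_smul_left hD hc hu hw] at h
    simpa [riemann] using h

theorem ricci_eq_trace (v w : TangentSpace (𝓡 4) x) :
    ricci D x v w = LinearMap.trace ℝ _ (riemannEnd hD x v w) := by
  rw [LinearMap.trace_eq_matrix_trace ℝ (coordBasis x), Matrix.trace, ricci]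
  refine Finset.sum_congr rfl fun i _ ↦ ?_
  rw [Matrix.diag_apply, LinearMap.toMatrix_apply]
  rfl

omit [T2Space M] in
theorem IsLeviCivita.mvfderiv_inner (hY : DiffFieldAt Y x) (hZ : DiffFieldAt Z x)
    (u : TangentSpace (𝓡 4) x) :
    mvfderiv (𝓡 4) (fun y ↦ g.inner y (Y y) (Z y)) x u =
      g.inner x (D Y x u) (Z x) + g.inner x (Y x) (D Z x u) :=
  hD.metric Y Z x u hY hZ

/-- The second derivatives of the function `g(W,W)` along commuting extensions of `u` and `v` agree.
By metric compatibility their difference is `2 g(R(u,v)w, w)` up to sign, since the product of first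
derivatives of `W` is symmetric. -/
theorem inner_riemann_self (u v w : TangentSpace (𝓡 4) x) :
    g.inner x (riemann D x u v w) w = 0 := by
  set W : VField M := FiberBundle.extend E4 w with hW
  have hWs : SmoothFieldAt W x := smoothFieldAt_extend w
  have hφ : SmoothFunAt (fun y ↦ g.inner y (W y) (W y)) x := g.smoothFunAt_inner hWs hWs
  have key : ∀ a b : TangentSpace (𝓡 4) x,
      mvfderiv (𝓡 4) (fun y ↦ mvfderiv (𝓡 4) (fun y ↦ g.inner y (W y) (W y)) y
        (FiberBundle.extend E4 a y)) x b =
      2 * (g.inner x (D (fun y ↦ D W y (FiberBundle.extend E4 a y)) x b) (W x)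
        + g.inner x (D W x a) (D W x b)) := by
    intro a b
    have ha := hD.smoothFieldAt_conn hWs (smoothFieldAt_extend a)
    have hc : (fun y ↦ mvfderiv (𝓡 4) (fun y ↦ g.inner y (W y) (W y)) y
        (FiberBundle.extend E4 a y)) =ᶠ[𝓝 x] (fun _ ↦ (2 : ℝ)) *
          fun y ↦ g.inner y (D W y (FiberBundle.extend E4 a y)) (W y) := by
      filter_upwards [hWs.eventually_diffFieldAt] with y hy
      rw [hD.mvfderiv_inner hy hy, g.symm y (W y)]
      simp [two_mul]
    rw [mvfderiv_congr hc, mvfderiv_mul mdifferentiableAt_const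
      (g.smoothFunAt_inner ha hWs).mdifferentiableAt, mvfderiv_const]
    simp [hD.mvfderiv_inner ha.diffFieldAt hWs.diffFieldAt]
  have hcomm := mvfderiv_extend_comm (ContMDiffAt.of_le hφ (WithTop.coe_le_coe.2 le_top)) u v
  rw [key, key] at hcomm
  have hs := g.symm x (D W x u) (D W x v)
  simp only [riemann, curvatureField, mlieBracket_extend, map_zero, FiberBundle.extend_apply_self,
    ← hW, map_sub, _root_.sub_apply, _root_.zero_apply]
  have hWx : W x = w := FiberBundle.extend_apply_self E4 w
  rw [hWx] at hcomm
  linarith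

end Curvature
end NEH

/-! ### Lorentzian linear algebra: causal vectors, null frames, traces -/

namespace NEH
open Filter Topology Bundle

section LorentzAlgebra

variable {M : Type*} [TopologicalSpace M] [ChartedSpace E4 M] [IsManifold (𝓡 4) ∞ M]
  (g : LorentzMetric M) {x : M}

theorem exists_lorentz_coordinates (x : M) :
    ∃ e : Module.Basis (Fin 4) ℝ (TangentSpace (𝓡 4) x), ∀ u v, g.inner x u v =
      e.repr u 0 * e.repr v 0 - e.repr u 1 * e.repr v 1 - e.repr u 2 * e.repr v 2 -
        e.repr u 3 * e.repr v 3 := by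
  obtain ⟨e, he⟩ := g.signature x
  refine ⟨e, fun u v ↦ ?_⟩
  conv_lhs => rw [← e.sum_repr u, ← e.sum_repr v]
  simp only [map_sum, map_smul, _root_.sum_apply, _root_.smul_apply, smul_eq_mul]
  simp_rw [he]
  simp [Fin.sum_univ_four]
  ring

theorem LorentzMetric.eq_zero_of_forall {u : TangentSpace (𝓡 4) x}
    (h : ∀ v, g.inner x u v = 0) : u = 0 := by
  obtain ⟨e, he⟩ := exists_lorentz_coordinates g x
  refine e.repr.injective (Finsupp.ext fun i ↦ ?_)
  have := h (e i)
  rw [he] at this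
  fin_cases i <;> simpa [Finsupp.single_apply] using this

theorem LorentzMetric.eq_of_forall {u u' : TangentSpace (𝓡 4) x}
    (h : ∀ v, g.inner x u v = g.inner x u' v) : u = u' :=
  sub_eq_zero.1 (g.eq_zero_of_forall fun v ↦ by simp [h v])

theorem cauchy_schwarz_three (a b c a' b' c' : ℝ) :
    (a * a' + b * b' + c * c') ^ 2 ≤ (a ^ 2 + b ^ 2 + c ^ 2) * (a' ^ 2 + b' ^ 2 + c' ^ 2) := by
  nlinarith [sq_nonneg (a * b' - b * a'), sq_nonneg (a * c' - c * a'), sq_nonneg (b * c' - c * b')]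

/-- A nonzero causal vector is not orthogonal to a timelike one. -/
theorem LorentzMetric.inner_ne_zero {l t : TangentSpace (𝓡 4) x} (hl : l ≠ 0)
    (hll : 0 ≤ g.inner x l l) (ht : 0 < g.inner x t t) : g.inner x l t ≠ 0 := by
  obtain ⟨e, he⟩ := exists_lorentz_coordinates g x
  intro h0
  apply hl
  rw [he] at h0 hll ht
  set a := e.repr l 1; set b := e.repr l 2; set c := e.repr l 3; set d := e.repr l 0
  set a' := e.repr t 1; set b' := e.repr t 2; set c' := e.repr t 3; set d' := e.repr t 0
  have hcs := cauchy_schwarz_three a b c a' b' c'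
  have h1 : a * a' + b * b' + c * c' = d * d' := by linarith
  have h2 : a ^ 2 + b ^ 2 + c ^ 2 ≤ d ^ 2 := by linarith
  have h3 : a' ^ 2 + b' ^ 2 + c' ^ 2 < d' ^ 2 := by linarith
  rw [h1] at hcs
  have hr : 0 ≤ a ^ 2 + b ^ 2 + c ^ 2 := by positivity
  have hd : d = 0 := by
    by_contra hd
    have hd2 : 0 < d ^ 2 := by positivity
    have hr' : 0 ≤ a' ^ 2 + b' ^ 2 + c' ^ 2 := by positivity
    nlinarith [mul_le_mul_of_nonneg_right h2 hr', mul_lt_mul_of_pos_left h3 hd2]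
  have hz : a ^ 2 + b ^ 2 + c ^ 2 = 0 := by
    rw [hd] at h2
    linarith
  have ha : a = 0 := by nlinarith [sq_nonneg a, sq_nonneg b, sq_nonneg c]
  have hb : b = 0 := by nlinarith [sq_nonneg a, sq_nonneg b, sq_nonneg c]
  have hc : c = 0 := by nlinarith [sq_nonneg a, sq_nonneg b, sq_nonneg c]
  refine e.repr.injective (Finsupp.ext fun i ↦ ?_)
  rw [map_zero]
  fin_cases i
  exacts [hd, ha, hb, hc]

/-- The time components of causal vectors with positive product have the same sign. -/
theorem causal_time_pos {r r' d d' s : ℝ} (h : r ≤ d ^ 2) (h' : r' < d' ^ 2)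
    (hr' : 0 ≤ r') (hcs : s ^ 2 ≤ r * r') (hpos : 0 < d' * d - s) :
    0 < d' * d := by
  by_contra hneg
  push Not at hneg
  have h1 : s < d' * d := by linarith
  have h2 : (d' * d) ^ 2 < s ^ 2 := by nlinarith
  nlinarith [mul_le_mul_of_nonneg_right h hr', mul_le_mul_of_nonneg_left h'.le (sq_nonneg d)]

/-- The hypotheses on `t` force the time components of `u` and `v` to have equal sign. For causal
vectors the product of time components dominates the spatial product by Cauchy-Schwarz. -/
theorem LorentzMetric.inner_nonneg_of_causal {t u v : TangentSpace (𝓡 4) x}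
    (ht : 0 < g.inner x t t) (hu : 0 ≤ g.inner x u u) (hv : 0 ≤ g.inner x v v)
    (htu : 0 < g.inner x t u) (htv : 0 < g.inner x t v) : 0 ≤ g.inner x u v := by
  obtain ⟨e, he⟩ := exists_lorentz_coordinates g x
  rw [he] at ht hu hv htu htv ⊢
  set a := e.repr u 1; set b := e.repr u 2; set c := e.repr u 3; set d := e.repr u 0
  set a' := e.repr t 1; set b' := e.repr t 2; set c' := e.repr t 3; set d' := e.repr t 0
  set a'' := e.repr v 1; set b'' := e.repr v 2; set c'' := e.repr v 3; set d'' := e.repr v 0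
  have p1 : 0 < d' * d := causal_time_pos (r := a ^ 2 + b ^ 2 + c ^ 2)
    (r' := a' ^ 2 + b' ^ 2 + c' ^ 2) (s := a * a' + b * b' + c * c') (by linarith) (by linarith)
    (by positivity) (cauchy_schwarz_three ..) (by linarith)
  have p2 : 0 < d' * d'' := causal_time_pos (r := a'' ^ 2 + b'' ^ 2 + c'' ^ 2)
    (r' := a' ^ 2 + b' ^ 2 + c' ^ 2) (s := a'' * a' + b'' * b' + c'' * c') (by linarith)
    (by linarith) (by positivity) (cauchy_schwarz_three ..) (by linarith)
  have p3 : 0 < d * d'' := by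
    have : 0 < (d' ^ 2) * (d * d'') := by nlinarith [mul_pos p1 p2]
    exact pos_of_mul_pos_right this (sq_nonneg _)
  have hcs := cauchy_schwarz_three a b c a'' b'' c''
  have hle : (a * a'' + b * b'' + c * c'') ^ 2 ≤ (d * d'') ^ 2 := by
    refine hcs.trans ?_
    rw [mul_pow]
    exact mul_le_mul (by linarith) (by linarith) (by positivity) (by positivity)
  have := abs_le_of_sq_le_sq hle p3.le
  linarith [(le_abs_self _).trans this]

theorem LorentzMetric.inner_nonpos_of_perp {l v : TangentSpace (𝓡 4) x} (hl : l ≠ 0)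
    (hll : g.inner x l l = 0) (hlv : g.inner x l v = 0) : g.inner x v v ≤ 0 := by
  by_contra h
  exact g.inner_ne_zero hl hll.ge (not_le.1 h) hlv

/-- A linear form which vanishes on the orthogonal space of `l` is a multiple of `g(l, ·)`. -/
theorem LorentzMetric.exists_eq_mul_inner {l N : TangentSpace (𝓡 4) x}
    (hN : g.inner x l N ≠ 0) (φ : TangentSpace (𝓡 4) x →ₗ[ℝ] ℝ)
    (h : ∀ v, g.inner x l v = 0 → φ v = 0) (v : TangentSpace (𝓡 4) x) :
    φ v = φ N / g.inner x l N * g.inner x l v := by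
  have h1 := h (v - (g.inner x l v / g.inner x l N) • N) (by simp [hN])
  rw [map_sub, map_smul, smul_eq_mul, sub_eq_zero] at h1
  rw [h1]
  ring

theorem LorentzMetric.eq_smul_of_perp {l N u : TangentSpace (𝓡 4) x}
    (hN : g.inner x l N ≠ 0) (h : ∀ v, g.inner x l v = 0 → g.inner x u v = 0) :
    u = (g.inner x u N / g.inner x l N) • l := by
  refine g.eq_of_forall fun v ↦ ?_
  have := g.exists_eq_mul_inner hN (g.inner x u).toLinearMap h v
  simpa using this

theorem finrank_perp {l N : TangentSpace (𝓡 4) x} (hN : g.inner x l N ≠ 0) :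
    Module.finrank ℝ (LinearMap.ker (g.inner x l).toLinearMap) = 3 := by
  have : FiniteDimensional ℝ (TangentSpace (𝓡 4) x) := .of_basis (coordBasis x)
  have hne : (g.inner x l).toLinearMap ≠ 0 := fun h ↦ hN (by
    have := congr($h N)
    simpa using this)
  have h1 := LinearMap.finrank_range_add_finrank_ker (g.inner x l).toLinearMap
  rw [LinearMap.range_eq_top.2 (LinearMap.surjective hne), finrank_top] at h1
  have h2 : Module.finrank ℝ (TangentSpace (𝓡 4) x) = 4 := by
    rw [Module.finrank_eq_card_basis (coordBasis x)]
    simp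
  rw [h2] at h1
  simp at h1
  omega

omit [IsManifold (𝓡 4) ∞ M] in
theorem finrank_tangentSpace (x : M) : Module.finrank ℝ (TangentSpace (𝓡 4) x) = 4 := by
  rw [Module.finrank_eq_card_basis (coordBasis x)]
  simp

/-- `l` and `n` are null vectors with `g(l, n) = 1`, both orthogonal to `e` and `f`, which span a
nondegenerate plane. -/
structure IsNullFrame (x : M) (l n e f : TangentSpace (𝓡 4) x) : Prop where
  ll : g.inner x l l = 0
  nn : g.inner x n n = 0
  ln : g.inner x l n = 1
  le : g.inner x l e = 0
  lf : g.inner x l f = 0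
  ne : g.inner x n e = 0
  nf : g.inner x n f = 0
  det : g.inner x e e * g.inner x f f - g.inner x e f ^ 2 ≠ 0

variable {g}
variable {l n e f : TangentSpace (𝓡 4) x}

/-- Rescale `N`, remove its components along `e` and `f` with the inverse Gram matrix, then subtract
the multiple of `l` that makes it null. The last two corrections do not change the product with `l`.
-/
theorem exists_isNullFrame {N : TangentSpace (𝓡 4) x} (hN : g.inner x l N ≠ 0)
    (hll : g.inner x l l = 0) (hle : g.inner x l e = 0) (hlf : g.inner x l f = 0)
    (hq : g.inner x e e * g.inner x f f - g.inner x e f ^ 2 ≠ 0) :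
    ∃ n, IsNullFrame g x l n e f := by
  obtain ⟨n₀, hn₀⟩ : ∃ n₀, g.inner x l n₀ = 1 := ⟨(g.inner x l N)⁻¹ • N, by simp [hN]⟩
  obtain ⟨n₁, h1, h2, h3⟩ : ∃ n₁, g.inner x l n₁ = 1 ∧ g.inner x n₁ e = 0 ∧
      g.inner x n₁ f = 0 := by
    refine ⟨n₀ - ((g.inner x f f * g.inner x n₀ e - g.inner x e f * g.inner x n₀ f) /
      (g.inner x e e * g.inner x f f - g.inner x e f ^ 2)) • e -
      ((g.inner x e e * g.inner x n₀ f - g.inner x e f * g.inner x n₀ e) /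
      (g.inner x e e * g.inner x f f - g.inner x e f ^ 2)) • f, ?_, ?_, ?_⟩
    · simp [hn₀, hle, hlf]
    · simp only [map_sub, map_smul, _root_.sub_apply, _root_.smul_apply, smul_eq_mul,
        g.symm x f e]
      generalize hq' : g.inner x e e * g.inner x f f - g.inner x e f ^ 2 = q at hq ⊢
      field_simp
      rw [← hq']
      ring
    · simp only [map_sub, map_smul, _root_.sub_apply, _root_.smul_apply, smul_eq_mul]
      generalize hq' : g.inner x e e * g.inner x f f - g.inner x e f ^ 2 = q at hq ⊢
      field_simp
      rw [← hq']
      ring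
  refine ⟨n₁ - (g.inner x n₁ n₁ / 2) • l, hll, ?_, ?_, hle, hlf, ?_, ?_, hq⟩
  · simp [g.symm x n₁ l, h1, hll]
    ring
  · simp [h1, hll]
  · simp [h2, hle]
  · simp [h3, hlf]

namespace IsNullFrame

variable (hF : IsNullFrame g x l n e f)
include hF

theorem linearIndependent : LinearIndependent ℝ ![l, n, e, f] := by
  rw [Fintype.linearIndependent_iff]
  intro c hc
  simp only [Fin.sum_univ_four, Matrix.cons_val] at hc
  have h1 := congr(g.inner x l $hc)
  have h2 := congr(g.inner x n $hc)
  have h3 := congr(g.inner x e $hc)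
  have h4 := congr(g.inner x f $hc)
  simp only [map_add, map_smul, smul_eq_mul, map_zero, hF.ll, hF.nn, hF.ln, hF.le, hF.lf, hF.ne,
    hF.nf, g.symm x n l, g.symm x e l, g.symm x f l, g.symm x e n, g.symm x f n, g.symm x f e]
    at h1 h2 h3 h4
  have hq := hF.det
  intro i
  fin_cases i
  · change c 0 = 0
    linarith
  · change c 1 = 0
    linarith
  · change c 2 = 0
    refine (mul_eq_zero.1 ?_).resolve_right hq
    linear_combination g.inner x f f * h3 - g.inner x e f * h4
  · change c 3 = 0
    refine (mul_eq_zero.1 ?_).resolve_right hq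
    linear_combination g.inner x e e * h4 - g.inner x e f * h3

theorem eq_zero {u : TangentSpace (𝓡 4) x} (h1 : g.inner x u l = 0) (h2 : g.inner x u n = 0)
    (h3 : g.inner x u e = 0) (h4 : g.inner x u f = 0) : u = 0 := by
  let b := basisOfLinearIndependentOfCardEqFinrank hF.linearIndependent
    (by rw [finrank_tangentSpace]; simp)
  refine g.eq_zero_of_forall fun v ↦ ?_
  rw [← b.sum_repr v]
  simp [b, Fin.sum_univ_four, h1, h2, h3, h4]

theorem eq_combination (u : TangentSpace (𝓡 4) x) :
    u = g.inner x u n • l + g.inner x u l • n +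
      ((g.inner x f f * g.inner x u e - g.inner x e f * g.inner x u f) /
        (g.inner x e e * g.inner x f f - g.inner x e f ^ 2)) • e +
      ((g.inner x e e * g.inner x u f - g.inner x e f * g.inner x u e) /
        (g.inner x e e * g.inner x f f - g.inner x e f ^ 2)) • f := by
  have hq := hF.det
  rw [← sub_eq_zero]
  refine hF.eq_zero ?_ ?_ ?_ ?_ <;>
  · simp only [map_add, map_sub, map_smul, _root_.add_apply, _root_.sub_apply, _root_.smul_apply,
      smul_eq_mul, hF.ll, hF.nn, hF.ln, hF.le, hF.lf, hF.ne, hF.nf, g.symm x n l, g.symm x e l,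
      g.symm x f l, g.symm x e n, g.symm x f n, g.symm x f e]
    generalize hq' : g.inner x e e * g.inner x f f - g.inner x e f ^ 2 = q at hq ⊢
    field_simp
    rw [← hq']
    ring

/-- The metric dual of the frame `(l, n, e, f)` is `n`, `l` and the pair `e`, `f` transformed by the
inverse Gram matrix. Multiplying by the Gram determinant clears the denominators. -/
theorem trace_eq (L : TangentSpace (𝓡 4) x →ₗ[ℝ] TangentSpace (𝓡 4) x) :
    (g.inner x e e * g.inner x f f - g.inner x e f ^ 2) * LinearMap.trace ℝ _ L =
      (g.inner x e e * g.inner x f f - g.inner x e f ^ 2) *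
        (g.inner x (L l) n + g.inner x (L n) l) +
      (g.inner x f f * g.inner x (L e) e + g.inner x e e * g.inner x (L f) f -
        g.inner x e f * (g.inner x (L e) f + g.inner x (L f) e)) := by
  have hq := hF.det
  let b := basisOfLinearIndependentOfCardEqFinrank hF.linearIndependent
    (by rw [finrank_tangentSpace]; simp)
  have hb : ∀ i, b i = ![l, n, e, f] i := fun i ↦ by simp [b]
  have hrepr : ∀ u, b.repr u = Finsupp.equivFunOnFinite.symm ![g.inner x u n, g.inner x u l,
      (g.inner x f f * g.inner x u e - g.inner x e f * g.inner x u f) /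
        (g.inner x e e * g.inner x f f - g.inner x e f ^ 2),
      (g.inner x e e * g.inner x u f - g.inner x e f * g.inner x u e) /
        (g.inner x e e * g.inner x f f - g.inner x e f ^ 2)] := by
    intro u
    rw [← LinearEquiv.eq_symm_apply, Module.Basis.repr_symm_apply,
      Finsupp.linearCombination_apply, Finsupp.sum_fintype _ _ (by simp)]
    simp only [Fin.sum_univ_four, hb, Finsupp.equivFunOnFinite_symm_apply_apply]
    exact hF.eq_combination u
  rw [LinearMap.trace_eq_matrix_trace ℝ b, Matrix.trace]
  simp only [Matrix.diag_apply, LinearMap.toMatrix_apply, hrepr, hb, Fin.sum_univ_four,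
    Finsupp.equivFunOnFinite_symm_apply_apply, Matrix.cons_val]
  field_simp
  ring

/-- The vector `g(e,e) f - g(e,f) e` is orthogonal to `l`, so its square is at most zero. That
square is `g(e,e)` times the Gram determinant. -/
theorem inner_mul_det_nonneg (hl : l ≠ 0) :
    0 ≤ (-g.inner x e e) * (g.inner x e e * g.inner x f f - g.inner x e f ^ 2) := by
  have hv := g.inner_nonpos_of_perp (l := l) (v := g.inner x e e • f - g.inner x e f • e) hl hF.ll
    (by simp [hF.le, hF.lf])
  simp only [map_sub, map_smul, _root_.sub_apply, _root_.smul_apply, smul_eq_mul,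
    g.symm x f e] at hv
  linarith

theorem inner_self_neg (hl : l ≠ 0) : g.inner x e e < 0 := by
  refine lt_of_le_of_ne (g.inner_nonpos_of_perp hl hF.ll hF.le) fun h0 ↦ ?_
  have hs : g.inner x e f ≠ 0 := fun h ↦ hF.det (by rw [h0, h]; ring)
  -- If `g(e,e) = 0`, this vector has square `g(e,f)² (2 - g(f,f))`. It is positive because `g(f,f)
  -- ≤ 0`, although the vector is orthogonal to `l`.
  have hv := g.inner_nonpos_of_perp (l := l)
    (v := (1 - g.inner x f f) • e + g.inner x e f • f) hl hF.ll (by simp [hF.le, hF.lf])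
  simp only [map_add, map_smul, _root_.add_apply, _root_.smul_apply, smul_eq_mul,
    g.symm x f e, h0] at hv
  have h1 := g.inner_nonpos_of_perp hl hF.ll hF.lf
  have h2 : 0 < g.inner x e f ^ 2 := by positivity
  nlinarith

theorem det_pos (hl : l ≠ 0) : 0 < g.inner x e e * g.inner x f f - g.inner x e f ^ 2 :=
  lt_of_le_of_ne (nonneg_of_mul_nonneg_right (hF.inner_mul_det_nonneg hl)
    (neg_pos.2 (hF.inner_self_neg hl))) hF.det.symm

end IsNullFrame

omit [IsManifold (𝓡 4) ∞ M] in
theorem CVec.bilin_eq_zero_iff {B : TangentSpace (𝓡 4) x →L[ℝ] TangentSpace (𝓡 4) x →L[ℝ] ℝ}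
    {v : TangentSpace (𝓡 4) x} {m : CVec (TangentSpace (𝓡 4) x)} :
    CVec.bilin B (CVec.ofReal v) m = 0 ↔ B v m.re = 0 ∧ B v m.im = 0 := by
  simp [CVec.bilin, CVec.ofReal, Complex.ext_iff]

theorem bilin_self_and_conj_iff {m : CVec (TangentSpace (𝓡 4) x)} :
    CVec.bilin (g.inner x) m m = 0 ∧ CVec.bilin (g.inner x) m m.conj = -1 ↔
      g.inner x m.re m.re = -1 / 2 ∧ g.inner x m.im m.im = -1 / 2 ∧ g.inner x m.re m.im = 0 := by
  simp only [CVec.bilin, CVec.conj, Complex.ext_iff, map_neg, g.symm x m.im m.re, Complex.zero_re,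
    Complex.zero_im, Complex.neg_re, Complex.neg_im, Complex.one_re, Complex.one_im]
  constructor
  · rintro ⟨⟨h1, h2⟩, h3, h4⟩
    refine ⟨?_, ?_, ?_⟩ <;> linarith
  · rintro ⟨h1, h2, h3⟩
    refine ⟨⟨?_, ?_⟩, ?_, ?_⟩ <;> linarith

theorem isNullTetrad_iff {m : CVec (TangentSpace (𝓡 4) x)} :
    IsNullTetrad g x l n m ↔ IsNullFrame g x l n m.re m.im ∧ g.inner x m.re m.re = -1 / 2 ∧
      g.inner x m.im m.im = -1 / 2 ∧ g.inner x m.re m.im = 0 := by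
  constructor
  · intro h
    obtain ⟨h1, h2, h3⟩ := bilin_self_and_conj_iff.1 ⟨h.mm, h.mmbar⟩
    have h4 := CVec.bilin_eq_zero_iff.1 h.lm
    have h5 := CVec.bilin_eq_zero_iff.1 h.nm
    exact ⟨⟨h.ll, h.nn, h.ln, h4.1, h4.2, h5.1, h5.2, by rw [h1, h2, h3]; norm_num⟩, h1, h2, h3⟩
  · rintro ⟨h, h'⟩
    obtain ⟨h1, h2⟩ := bilin_self_and_conj_iff.2 h'
    exact ⟨h.ll, h.nn, h.ln, CVec.bilin_eq_zero_iff.2 ⟨h.le, h.lf⟩,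
      CVec.bilin_eq_zero_iff.2 ⟨h.ne, h.nf⟩, h1, h2⟩

/-- For uniqueness, the difference of two completions is orthogonal to `l`, `Re m` and `Im m`, hence
a multiple of `l`. Nullness of both vectors makes the multiple zero. -/
theorem existsUnique_isNullTetrad {N : TangentSpace (𝓡 4) x} {m : CVec (TangentSpace (𝓡 4) x)}
    (hN : g.inner x l N ≠ 0) (hll : g.inner x l l = 0)
    (hlm : CVec.bilin (g.inner x) (CVec.ofReal l) m = 0)
    (hmm : CVec.bilin (g.inner x) m m = 0) (hmm' : CVec.bilin (g.inner x) m m.conj = -1) :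
    ∃! k, IsNullTetrad g x l k m := by
  obtain ⟨h1, h2, h3⟩ := bilin_self_and_conj_iff.1 ⟨hmm, hmm'⟩
  have h4 := CVec.bilin_eq_zero_iff.1 hlm
  obtain ⟨k, hk⟩ := exists_isNullFrame hN hll h4.1 h4.2 (by rw [h1, h2, h3]; norm_num)
  refine ⟨k, isNullTetrad_iff.2 ⟨hk, h1, h2, h3⟩, fun k' hk' ↦ ?_⟩
  have hk' := (isNullTetrad_iff.1 hk').1
  have hd : k' - k - g.inner x (k' - k) k • l = 0 := by
    refine hk.eq_zero ?_ ?_ ?_ ?_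
    · simp [g.symm x _ l, hk.ln, hk'.ln, hk.ll]
    · simp [hk.ln, hk.nn]
    · simp [hk.ne, hk'.ne, hk.le]
    · simp [hk.nf, hk'.nf, hk.lf]
  have hd' : k' = k + g.inner x (k' - k) k • l := by
    rw [← sub_eq_zero, ← hd]
    abel
  have h5 := hk'.nn
  rw [hd'] at h5
  have h6 : g.inner x (k' - k) k = 0 := by
    generalize g.inner x (k' - k) k = a at h5
    simp [hk.nn, hk.ll, hk.ln, g.symm x k l] at h5
    linarith
  rw [hd', h6]
  simp

/-- A plane orthogonal to a null vector is spanned by the real and imaginary part of the complex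
vector of a null tetrad. Hence the trace of a bilinear form over such a plane is an expansion. -/
theorem trace_eq_zero_of_expansion {B : TangentSpace (𝓡 4) x →L[ℝ] TangentSpace (𝓡 4) x}
    (hl : l ≠ 0) (hF : IsNullFrame g x l n e f)
    (hexp : ∀ k m, IsNullTetrad g x l k m →
      - CVec.bilin (g.inner x) (CVec.map B m) m.conj
        - CVec.bilin (g.inner x) (CVec.map B m.conj) m = 0) :
    g.inner x (B e) e * g.inner x f f + g.inner x (B f) f * g.inner x e e -
      g.inner x e f * (g.inner x (B e) f + g.inner x (B f) e) = 0 := by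
  have hp1 : 0 < -g.inner x e e := neg_pos.2 (hF.inner_self_neg hl)
  have hq1 := hF.det_pos hl
  set p := g.inner x e e with hp
  set r := g.inner x f f with hr
  set s := g.inner x e f with hs
  have hp0 : p ≠ 0 := by
    rintro h
    simp [h] at hp1
  -- Gram-Schmidt: `e` and `p f - s e` are orthogonal with negative squares `p` and `p (p r - s²)`.
  -- Dividing by these roots gives square `-1/2`, as required of the real and imaginary parts of a
  -- tetrad's `m`.
  have hα : Real.sqrt (-2 * p) ^ 2 = -2 * p := Real.sq_sqrt (by linarith)
  have hβ : Real.sqrt (-2 * p * (p * r - s ^ 2)) ^ 2 = -2 * p * (p * r - s ^ 2) :=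
    Real.sq_sqrt (by nlinarith)
  have hα0 : Real.sqrt (-2 * p) ≠ 0 := by
    intro h
    rw [h] at hα
    apply hp0
    linarith
  have hβ0 : Real.sqrt (-2 * p * (p * r - s ^ 2)) ≠ 0 := by
    intro h
    rw [h] at hβ
    have := mul_pos hp1 hq1
    nlinarith
  set α := Real.sqrt (-2 * p)
  set β := Real.sqrt (-2 * p * (p * r - s ^ 2))
  set u := α⁻¹ • e with hu
  set v := β⁻¹ • (p • f - s • e) with hv
  have huu : g.inner x u u = -1 / 2 := by
    simp only [hu, map_smul, _root_.smul_apply, smul_eq_mul, ← hp]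
    field_simp
    linarith
  have hvv : g.inner x v v = -1 / 2 := by
    simp only [hv, map_sub, map_smul, _root_.sub_apply, _root_.smul_apply, smul_eq_mul,
      g.symm x f e, ← hp, ← hr, ← hs]
    field_simp
    linarith
  have huv : g.inner x u v = 0 := by
    simp only [hu, hv, map_sub, map_smul, _root_.smul_apply, smul_eq_mul, ← hp, ← hs]
    ring
  have hk : IsNullTetrad g x l n ⟨u, v⟩ := by
    refine isNullTetrad_iff.2 ⟨⟨hF.ll, hF.nn, hF.ln, ?_, ?_, ?_, ?_, ?_⟩, huu, hvv, huv⟩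
    · simp [hu, hF.le]
    · simp [hv, hF.le, hF.lf]
    · simp [hu, hF.ne]
    · simp [hv, hF.ne, hF.nf]
    · simp only [huu, hvv, huv]
      norm_num
  have h1 := congr(Complex.re $(hexp n ⟨u, v⟩ hk))
  simp only [CVec.bilin, CVec.map, CVec.conj, map_neg, Complex.sub_re, Complex.neg_re,
    Complex.zero_re, _root_.neg_apply] at h1
  have h2 : g.inner x (B u) u + g.inner x (B v) v = 0 := by linarith
  simp only [hu, hv, map_sub, map_smul, _root_.sub_apply, _root_.smul_apply, smul_eq_mul] at h2
  have hα2 : α⁻¹ * α⁻¹ = (-2 * p)⁻¹ := by rw [← hα, sq, mul_inv]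
  have hβ2 : β⁻¹ * β⁻¹ = (-2 * p * (p * r - s ^ 2))⁻¹ := by rw [← hβ, sq, mul_inv]
  have h3 : (-2 * p)⁻¹ * g.inner x (B e) e + (-2 * p * (p * r - s ^ 2))⁻¹ *
      (p * (p * g.inner x (B f) f - s * g.inner x (B f) e) -
        s * (p * g.inner x (B e) f - s * g.inner x (B e) e)) = 0 := by
    rw [← hα2, ← hβ2, ← h2]
    ring
  field_simp at h3
  have h4 : p * (g.inner x (B e) e * r + g.inner x (B f) f * p -
      s * (g.inner x (B e) f + g.inner x (B f) e)) = 0 := by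
    linear_combination -h3
  exact (mul_eq_zero.1 h4).resolve_left hp0

end LorentzAlgebra
end NEH

/-! ### Coordinate functions dual to the chart-constant frame -/

namespace NEH
open Filter Topology Bundle

section Frame

variable {E : Type*} [NormedAddCommGroup E] [NormedSpace ℝ E]
  {H : Type*} [TopologicalSpace H] {I : ModelWithCorners ℝ E H}
  {N : Type*} [TopologicalSpace N] [ChartedSpace H N] [IsManifold I ∞ N]

/-- The coordinate functions of the preferred chart are dual to the constant extensions. -/
theorem exists_coordinates {ι : Type*} [Fintype ι] [FiniteDimensional ℝ E] {x : N}
    (b : Module.Basis ι ℝ (TangentSpace I x)) :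
    ∃ φ : ι → N → ℝ, (∀ i, ContMDiffAt I 𝓘(ℝ, ℝ) ∞ (φ i) x) ∧
      ∀ᶠ y in 𝓝 x, ∀ w : TangentSpace I y,
        w = ∑ i, mvfderiv I (φ i) y w • FiberBundle.extend E (b i) y := by
  have : IsManifold I 1 N := .of_le (n := ∞) (by simp)
  let t := trivializationAt E (TangentSpace I : N → Type _) x
  have hxt : x ∈ t.baseSet := FiberBundle.mem_baseSet_trivializationAt' x
  let L := t.continuousLinearEquivAt ℝ x hxt
  let c : Module.Basis ι ℝ E := b.map L.toLinearEquiv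
  have hc : ∀ i, c i = (t ⟨x, b i⟩).2 := by
    intro i
    simp [c, L]
  let ℓ : ι → E →L[ℝ] ℝ := fun i ↦ LinearMap.toContinuousLinearMap (c.coord i)
  refine ⟨fun i ↦ ℓ i ∘ extChartAt I x, fun i ↦ ?_, ?_⟩
  · exact (ℓ i).contDiff.contDiffAt.contMDiffAt.comp x contMDiffAt_extChartAt
  · filter_upwards [(chartAt H x).open_source.mem_nhds (mem_chart_source H x)] with y hy w
    have hmd : MDifferentiableAt I 𝓘(ℝ, E) (extChartAt I x) y := mdifferentiableAt_extChartAt hy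
    have hinj : Function.Injective (mvfderiv I (extChartAt I x) y) := by
      obtain ⟨e, he⟩ := isInvertible_mfderiv_extChartAt (I := I) (x := x) (y := y) (by simpa using hy)
      intro u v huv
      refine e.injective ?_
      have h1 : ∀ u, e u = mvfderiv I (extChartAt I x) y u := fun u ↦ congr($he u)
      exact (h1 u).trans (huv.trans (h1 v).symm)
    refine hinj ?_
    rw [map_sum]
    have h2 : ∀ i, mvfderiv I (ℓ i ∘ extChartAt I x) y w =
        c.repr (mvfderiv I (extChartAt I x) y w) i := by
      intro i
      rw [mvfderiv_comp_fderiv (ℓ i).differentiableAt hmd, ContinuousLinearMap.fderiv]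
      rfl
    simp only [map_smul, h2, mfderiv_extChartAt_extend hy]
    change _ = ∑ i, c.repr (mvfderiv I (extChartAt I x) y w) i • (t ⟨x, b i⟩).2
    simp only [← hc]
    exact (c.sum_repr _).symm

omit [IsManifold I ∞ N] in
theorem mvfderiv_sum_mul {ι : Type*} {s : Finset ι} {a b : ι → N → ℝ} {x : N}
    (ha : ∀ i ∈ s, MDifferentiableAt I 𝓘(ℝ, ℝ) (a i) x)
    (hb : ∀ i ∈ s, MDifferentiableAt I 𝓘(ℝ, ℝ) (b i) x) (u : TangentSpace I x) :
    MDifferentiableAt I 𝓘(ℝ, ℝ) (fun y ↦ ∑ i ∈ s, a i y * b i y) x ∧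
    mvfderiv I (fun y ↦ ∑ i ∈ s, a i y * b i y) x u =
      ∑ i ∈ s, (a i x * mvfderiv I (b i) x u + mvfderiv I (a i) x u * b i x) := by
  classical
  induction s using Finset.induction_on with
  | empty => simpa using! ⟨mdifferentiableAt_const, by simp [mvfderiv_const]⟩
  | insert i s hi ih =>
    obtain ⟨h1, h2⟩ := ih (fun j hj ↦ ha j (Finset.mem_insert_of_mem hj))
      (fun j hj ↦ hb j (Finset.mem_insert_of_mem hj))
    have hai := ha i (Finset.mem_insert_self ..)
    have hbi := hb i (Finset.mem_insert_self ..)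
    have h3 : MDifferentiableAt I 𝓘(ℝ, ℝ) (fun y ↦ a i y * b i y) x := hai.mul hbi
    simp only [Finset.sum_insert hi]
    refine ⟨h3.add h1, ?_⟩
    rw [mvfderiv_fun_add h3 h1, mvfderiv_fun_mul hai hbi, _root_.add_apply, h2]
    simp [mul_comm]

end Frame

/-! ### Second fundamental form and tangent space of a null hypersurface -/

section Hypersurface

variable {E' : Type*} [NormedAddCommGroup E'] [NormedSpace ℝ E']
  {H' : Type*} [TopologicalSpace H'] {J : ModelWithCorners ℝ E' H'} [J.Boundaryless]
  {N : Type*} [TopologicalSpace N] [ChartedSpace H' N] [IsManifold J ∞ N]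
  {M : Type*} [TopologicalSpace M] [ChartedSpace E4 M] [IsManifold (𝓡 4) ∞ M]
  {g : LorentzMetric M} {D : Connection M} {ψ : N → M} {p : N} {l : VField M}

omit [J.Boundaryless] [IsManifold J ∞ N] [IsManifold (𝓡 4) ∞ M] in
theorem mvfderiv_comp_apply' {f : M → ℝ} (hf : SmoothFunAt f (ψ p))
    (hψ : MDifferentiableAt J (𝓡 4) ψ p) (ξ : TangentSpace J p) :
    mvfderiv J (fun q ↦ f (ψ q)) p ξ = mvfderiv (𝓡 4) f (ψ p) (mfderiv J (𝓡 4) ψ p ξ) :=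
  mvfderiv_comp_apply p hf.mdifferentiableAt hψ ξ

theorem conn_extend_comm (hD : IsLeviCivita g D) {x : M} (v w : TangentSpace (𝓡 4) x) :
    D (FiberBundle.extend E4 v) x w = D (FiberBundle.extend E4 w) x v := by
  have h := hD.torsion_free (FiberBundle.extend E4 w) (FiberBundle.extend E4 v) x
    (smoothFieldAt_extend w).diffFieldAt (smoothFieldAt_extend v).diffFieldAt
  rw [mlieBracket_extend, FiberBundle.extend_apply_self, FiberBundle.extend_apply_self] at h
  exact sub_eq_zero.1 h

/-- The second fundamental form of a hypersurface with normal field `l` is symmetric. -/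
theorem second_fundamental_form_symm (hD : IsLeviCivita g D)
    (hψ : ContMDiffAt J (𝓡 4) ∞ ψ p) (hl : SmoothFieldAt l (ψ p))
    (hn : ∀ᶠ q in 𝓝 p, ∀ v, g.inner (ψ q) (l (ψ q)) (mfderiv J (𝓡 4) ψ q v) = 0)
    (ξ η : TangentSpace J p) :
    g.inner (ψ p) (D l (ψ p) (mfderiv J (𝓡 4) ψ p ξ)) (mfderiv J (𝓡 4) ψ p η) =
      g.inner (ψ p) (D l (ψ p) (mfderiv J (𝓡 4) ψ p η)) (mfderiv J (𝓡 4) ψ p ξ) := by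
  have : IsManifold J 1 N := .of_le (n := ∞) (by simp)
  have : IsManifold (𝓡 4) 1 M := .of_le (n := ∞) (by simp)
  set x := ψ p with hx
  let b : Module.Basis (Fin 4) ℝ (TangentSpace (𝓡 4) x) := coordBasis x
  obtain ⟨φ, hφ, hsum⟩ := exists_coordinates b
  have hψd : MDifferentiableAt J (𝓡 4) ψ p := hψ.mdifferentiableAt (by simp)
  have hφψ : ∀ k, ContMDiffAt J 𝓘(ℝ, ℝ) ∞ (fun q ↦ φ k (ψ q)) p := fun k ↦ (hφ k).comp p hψ
  have hω : ∀ k, SmoothFunAt (fun y ↦ g.inner y (l y) (FiberBundle.extend E4 (b k) y)) x :=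
    fun k ↦ g.smoothFunAt_inner hl (smoothFieldAt_extend _)
  have hωψ : ∀ k, ContMDiffAt J 𝓘(ℝ, ℝ) ∞
      (fun q ↦ g.inner (ψ q) (l (ψ q)) (FiberBundle.extend E4 (b k) (ψ q))) p :=
    fun k ↦ (hω k).comp p hψ
  have hsm : ∀ (k : Fin 4) (ζ : TangentSpace J p), ContMDiffAt J 𝓘(ℝ, ℝ) ∞
      (fun q ↦ mvfderiv J (fun q ↦ φ k (ψ q)) q (FiberBundle.extend E' ζ q)) p := fun k ζ ↦
    contMDiffAt_mvfderiv_apply (hφψ k) (FiberBundle.contMDiffAt_extend J E' ζ)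
  have hφev : ∀ᶠ q in 𝓝 p, ∀ k, MDifferentiableAt (𝓡 4) 𝓘(ℝ, ℝ) (φ k) (ψ q) := by
    rw [eventually_all]
    exact fun k ↦ hψ.continuousAt.eventually (SmoothFunAt.eventually_mdifferentiableAt (hφ k))
  have hψev : ∀ᶠ q in 𝓝 p, MDifferentiableAt J (𝓡 4) ψ q := by
    have h1 : ContMDiffAt J (𝓡 4) 1 ψ p := hψ.of_le (by simp)
    filter_upwards [(contMDiffAt_iff_contMDiffAt_nhds (by simp)).1 h1] with q hq
    exact hq.mdifferentiableAt (by simp)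
  -- This is the derivative along `ξ` of the identity `g(l, dψ η) = 0`, with `dψ η` written in the
  -- chart-constant frame of `M` because it is defined only along `ψ`.
  have key : ∀ ξ η : TangentSpace J p,
      ∑ k, (g.inner x (l x) (b k) * mvfderiv J (fun q ↦ mvfderiv J (fun q ↦ φ k (ψ q)) q
        (FiberBundle.extend E' η q)) p ξ +
      (g.inner x (D l x (mfderiv J (𝓡 4) ψ p ξ)) (b k) +
        g.inner x (l x) (D (FiberBundle.extend E4 (b k)) x (mfderiv J (𝓡 4) ψ p ξ))) *
      mvfderiv (𝓡 4) (φ k) x (mfderiv J (𝓡 4) ψ p η)) = 0 := by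
    intro ξ η
    have hzero : (fun q ↦ ∑ k, g.inner (ψ q) (l (ψ q)) (FiberBundle.extend E4 (b k) (ψ q)) *
        mvfderiv J (fun q ↦ φ k (ψ q)) q (FiberBundle.extend E' η q)) =ᶠ[𝓝 p] fun _ ↦ 0 := by
      filter_upwards [hn, hφev, hψev, hψ.continuousAt.eventually hsum] with q h1 h2 h3 h4
      have h5 := h1 (FiberBundle.extend E' η q)
      rw [h4 (mfderiv J (𝓡 4) ψ q (FiberBundle.extend E' η q)), map_sum] at h5
      rw [← h5]
      refine Finset.sum_congr rfl fun k _ ↦ ?_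
      rw [map_smul, smul_eq_mul, mul_comm]
      congr 1
      exact mvfderiv_comp_apply q (h2 k) h3 _
    have h1 := (mvfderiv_sum_mul (s := Finset.univ) (fun k _ ↦ (hωψ k).mdifferentiableAt (by simp))
      (fun k _ ↦ (hsm k η).mdifferentiableAt (by simp)) ξ).2
    rw [mvfderiv_congr hzero, mvfderiv_const, _root_.zero_apply] at h1
    rw [h1]
    refine Finset.sum_congr rfl fun k _ ↦ ?_
    rw [FiberBundle.extend_apply_self, mvfderiv_comp_apply' (hφ k) hψd,
      mvfderiv_comp_apply' (hω k) hψd,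
      hD.mvfderiv_inner hl.diffFieldAt (smoothFieldAt_extend _).diffFieldAt,
      FiberBundle.extend_apply_self, FiberBundle.extend_apply_self]
  have hsumx := hsum.self_of_nhds
  simp only [FiberBundle.extend_apply_self] at hsumx
  -- The middle term is the second fundamental form. The others are symmetric in `ξ` and `η`: the
  -- first by equality of second derivatives, the last because the frame fields commute and torsion
  -- vanishes.
  have key2 : ∀ ξ η : TangentSpace J p,
      ∑ k, g.inner x (l x) (b k) * mvfderiv J (fun q ↦ mvfderiv J (fun q ↦ φ k (ψ q)) q
        (FiberBundle.extend E' η q)) p ξ +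
      g.inner x (D l x (mfderiv J (𝓡 4) ψ p ξ)) (mfderiv J (𝓡 4) ψ p η) +
      ∑ k, ∑ j, mvfderiv (𝓡 4) (φ j) x (mfderiv J (𝓡 4) ψ p ξ) *
        mvfderiv (𝓡 4) (φ k) x (mfderiv J (𝓡 4) ψ p η) *
        g.inner x (l x) (D (FiberBundle.extend E4 (b k)) x (b j)) = 0 := by
    intro ξ η
    rw [← key ξ η, Finset.sum_add_distrib, add_assoc]
    congr 1
    simp only [add_mul, Finset.sum_add_distrib]
    congr 1
    · conv_lhs => rw [hsumx (mfderiv J (𝓡 4) ψ p η)]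
      rw [map_sum]
      exact Finset.sum_congr rfl fun k _ ↦ by rw [map_smul, smul_eq_mul, mul_comm]
    · refine Finset.sum_congr rfl fun k _ ↦ ?_
      conv_rhs => rw [hsumx (mfderiv J (𝓡 4) ψ p ξ)]
      rw [map_sum, map_sum, Finset.sum_mul]
      exact Finset.sum_congr rfl fun j _ ↦ by rw [map_smul, map_smul, smul_eq_mul]; ring
  have h1 := key2 ξ η
  have h2 := key2 η ξ
  have h3 : ∀ k, mvfderiv J (fun q ↦ mvfderiv J (fun q ↦ φ k (ψ q)) q
        (FiberBundle.extend E' η q)) p ξ = mvfderiv J (fun q ↦ mvfderiv J (fun q ↦ φ k (ψ q)) q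
        (FiberBundle.extend E' ξ q)) p η := fun k ↦
    mvfderiv_extend_comm ((hφψ k).of_le (WithTop.coe_le_coe.2 le_top)) ξ η
  simp only [h3] at h1
  have h4 : ∑ k, ∑ j, mvfderiv (𝓡 4) (φ j) x (mfderiv J (𝓡 4) ψ p ξ) *
        mvfderiv (𝓡 4) (φ k) x (mfderiv J (𝓡 4) ψ p η) *
        g.inner x (l x) (D (FiberBundle.extend E4 (b k)) x (b j)) =
      ∑ k, ∑ j, mvfderiv (𝓡 4) (φ j) x (mfderiv J (𝓡 4) ψ p η) *
        mvfderiv (𝓡 4) (φ k) x (mfderiv J (𝓡 4) ψ p ξ) *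
        g.inner x (l x) (D (FiberBundle.extend E4 (b k)) x (b j)) := by
    rw [Finset.sum_comm]
    refine Finset.sum_congr rfl fun k _ ↦ Finset.sum_congr rfl fun j _ ↦ ?_
    rw [conn_extend_comm hD]
    ring
  linarith

omit [J.Boundaryless] [IsManifold J ∞ N] [IsManifold (𝓡 4) ∞ M] in
/-- A function vanishing on a hypersurface has no derivative along it. -/
theorem mvfderiv_eq_zero_of_comp {f : M → ℝ} (hψ : MDifferentiableAt J (𝓡 4) ψ p)
    (hf : MDifferentiableAt (𝓡 4) 𝓘(ℝ, ℝ) f (ψ p)) (h : ∀ᶠ q in 𝓝 p, f (ψ q) = 0)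
    (ξ : TangentSpace J p) : mvfderiv (𝓡 4) f (ψ p) (mfderiv J (𝓡 4) ψ p ξ) = 0 := by
  have h1 := mvfderiv_comp_apply p hf hψ ξ
  have h2 : f ∘ ψ =ᶠ[𝓝 p] fun _ ↦ 0 := h
  rw [mvfderiv_congr h2, mvfderiv_const] at h1
  exact h1.symm

omit [IsManifold J ∞ N] in
-- The tangent space of the hypersurface lies in `l^⊥`, and both have dimension three, so they
-- coincide. This allows differentiation of identities on the horizon along any vector orthogonal to
-- `l`.
theorem exists_mfderiv_eq_of_perp {v N' : TangentSpace (𝓡 4) (ψ p)}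
    (hdim : Module.finrank ℝ E' = 3) (hψ : Manifold.IsImmersionAt J (𝓡 4) ∞ ψ p)
    (hN : g.inner (ψ p) (l (ψ p)) N' ≠ 0)
    (hn : ∀ v, g.inner (ψ p) (l (ψ p)) (mfderiv J (𝓡 4) ψ p v) = 0)
    (hv : g.inner (ψ p) (l (ψ p)) v = 0) : ∃ ξ, mfderiv J (𝓡 4) ψ p ξ = v := by
  have hfd : FiniteDimensional ℝ (TangentSpace (𝓡 4) (ψ p)) := .of_basis (coordBasis _)
  have hinj := mfderiv_injective_of_isImmersionAt hψ
  have hle : LinearMap.range (mfderiv J (𝓡 4) ψ p).toLinearMap ≤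
      LinearMap.ker (g.inner (ψ p) (l (ψ p))).toLinearMap := by
    rintro _ ⟨ξ, rfl⟩
    exact hn ξ
  have heq := Submodule.eq_of_le_of_finrank_eq hle (by
    rw [finrank_perp g hN, LinearMap.finrank_range_of_inj hinj]
    exact hdim)
  have : v ∈ LinearMap.ker (g.inner (ψ p) (l (ψ p))).toLinearMap := hv
  rw [← heq] at this
  exact this

end Hypersurface
end NEH

/-! ### Null normals of the horizon and positivity of `Ric(l,l)` -/

namespace NEH
open Filter Topology Bundle

section Horizon

variable {M : Type*} [TopologicalSpace M] [ChartedSpace E4 M] [IsManifold (𝓡 4) ∞ M]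
  {g : LorentzMetric M} {τ : TimeOrientation g} {D : Connection M} {T : TwoTensor M}
  {ψ : ℝ × S2 → M} {l : VField M} {y : M} {v w : TangentSpace (𝓡 4) y}

section NullNormal

variable (hl : IsNullNormal g ψ l) (hy : y ∈ Set.range ψ)
include hl hy

theorem IsNullNormal.smoothFieldAt : SmoothFieldAt l y := by
  obtain ⟨p, rfl⟩ := hy
  exact (hl p).1

theorem IsNullNormal.ne_zero : l y ≠ 0 := by
  obtain ⟨p, rfl⟩ := hy
  exact (hl p).2.1

theorem IsNullNormal.inner_self : g.inner y (l y) (l y) = 0 := by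
  obtain ⟨p, rfl⟩ := hy
  exact (hl p).2.2.1

theorem IsNullNormal.inner_time_ne_zero (τ : TimeOrientation g) :
    g.inner y (l y) (τ.field y) ≠ 0 :=
  g.inner_ne_zero (hl.ne_zero hy) (hl.inner_self hy).ge (τ.timelike y)

theorem IsNullNormal.exists_mfderiv_eq (τ : TimeOrientation g)
    (hψ : Manifold.IsSmoothEmbedding (𝓘(ℝ, ℝ).prod (𝓡 2)) (𝓡 4) ∞ ψ)
    (hv : g.inner y (l y) v = 0) :
    ∃ p, ∃ h : ψ p = y, ∃ ξ, h ▸ mfderiv (𝓘(ℝ, ℝ).prod (𝓡 2)) (𝓡 4) ψ p ξ = v := by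
  have hN := hl.inner_time_ne_zero hy τ
  obtain ⟨p, rfl⟩ := hy
  exact ⟨p, rfl, exists_mfderiv_eq_of_perp (by simp) (hψ.isImmersion.isImmersionAt p) hN
    (hl p).2.2.2 hv⟩

theorem IsNullNormal.mvfderiv_eq_zero (τ : TimeOrientation g)
    (hψ : Manifold.IsSmoothEmbedding (𝓘(ℝ, ℝ).prod (𝓡 2)) (𝓡 4) ∞ ψ)
    {f : M → ℝ} (hf : SmoothFunAt f y) (h : ∀ z ∈ Set.range ψ, f z = 0)
    (hv : g.inner y (l y) v = 0) : mvfderiv (𝓡 4) f y v = 0 := by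
  obtain ⟨p, rfl, ξ, rfl⟩ := hl.exists_mfderiv_eq hy τ hψ hv
  exact mvfderiv_eq_zero_of_comp (hψ.contMDiff.mdifferentiable (by simp) p) hf.mdifferentiableAt
    (.of_forall fun q ↦ h _ ⟨q, rfl⟩) ξ

variable (hD : IsLeviCivita g D)
include hD

theorem IsNullNormal.inner_conn_self (τ : TimeOrientation g)
    (hψ : Manifold.IsSmoothEmbedding (𝓘(ℝ, ℝ).prod (𝓡 2)) (𝓡 4) ∞ ψ)
    (hv : g.inner y (l y) v = 0) : g.inner y (D l y v) (l y) = 0 := by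
  have hs := hl.smoothFieldAt hy
  have h1 := hl.mvfderiv_eq_zero hy τ hψ (g.smoothFunAt_inner hs hs)
    (fun z hz ↦ hl.inner_self hz) hv
  rw [hD.mvfderiv_inner hs.diffFieldAt hs.diffFieldAt, g.symm y (l y)] at h1
  linarith

theorem IsNullNormal.inner_conn_symm (τ : TimeOrientation g)
    (hψ : Manifold.IsSmoothEmbedding (𝓘(ℝ, ℝ).prod (𝓡 2)) (𝓡 4) ∞ ψ)
    (hv : g.inner y (l y) v = 0) (hw : g.inner y (l y) w = 0) :
    g.inner y (D l y v) w = g.inner y (D l y w) v := by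
  have hN := hl.inner_time_ne_zero hy τ
  obtain ⟨p, rfl⟩ := hy
  have hi := hψ.isImmersion.isImmersionAt p
  obtain ⟨ξ, rfl⟩ := exists_mfderiv_eq_of_perp (by simp) hi hN (hl p).2.2.2 hv
  obtain ⟨η, rfl⟩ := exists_mfderiv_eq_of_perp (by simp) hi hN (hl p).2.2.2 hw
  exact second_fundamental_form_symm hD (hψ.contMDiff p) (hl p).1
    (.of_forall fun q ↦ (hl q).2.2.2) ξ η

/-- The generators are pregeodesics: for `v` orthogonal to `l`, symmetry gives `g(∇_l l, v) = g(∇_v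
l, l)`, which is half the derivative of `g(l,l)` along the horizon and so vanishes. -/
theorem IsNullNormal.exists_conn_self_eq_smul (τ : TimeOrientation g)
    (hψ : Manifold.IsSmoothEmbedding (𝓘(ℝ, ℝ).prod (𝓡 2)) (𝓡 4) ∞ ψ) :
    ∃ κ : ℝ, D l y (l y) = κ • l y :=
  ⟨_, g.eq_smul_of_perp (hl.inner_time_ne_zero hy τ) fun _ hv ↦
    (hl.inner_conn_symm hy hD τ hψ (hl.inner_self hy) hv).trans
      (hl.inner_conn_self hy hD τ hψ hv)⟩

theorem IsNullNormal.exists_inner_conn_add (τ : TimeOrientation g)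
    (hψ : Manifold.IsSmoothEmbedding (𝓘(ℝ, ℝ).prod (𝓡 2)) (𝓡 4) ∞ ψ) :
    ∃ K : ℝ, ∀ v, g.inner y (D l y (l y)) v + g.inner y (l y) (D l y v) =
      K * g.inner y (l y) v :=
  ⟨_, g.exists_eq_mul_inner (hl.inner_time_ne_zero hy τ)
    (g.inner y (D l y (l y)) + (g.inner y (l y)).comp (D l y)).toLinearMap fun v hv ↦ by
      obtain ⟨κ, hκ⟩ := hl.exists_conn_self_eq_smul hy hD τ hψ
      have h1 := hl.inner_conn_self hy hD τ hψ hv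
      simp [hκ, hv, g.symm y (l y) (D l y v), h1]⟩

/-- This replaces the derivative of `∇_l l = κ l`, in which `κ` lives only on the horizon and its
smoothness is not established. Instead `κ` is eliminated: with `Y = ∇_l l`, the smooth function
`g(l,N) g(Y,W) - g(Y,N) g(l,W)` vanishes on the horizon and is differentiated along `v`. -/
theorem IsNullNormal.exists_inner_conn_conn [T2Space M] (τ : TimeOrientation g)
    (hψ : Manifold.IsSmoothEmbedding (𝓘(ℝ, ℝ).prod (𝓡 2)) (𝓡 4) ∞ ψ) :
    ∃ κ : ℝ, D l y (l y) = κ • l y ∧ ∀ v w, g.inner y (l y) v = 0 → g.inner y (l y) w = 0 →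
      g.inner y (D (fun z ↦ D l z (l z)) y v) w = κ * g.inner y (D l y v) w := by
  obtain ⟨κ, hκ⟩ := hl.exists_conn_self_eq_smul hy hD τ hψ
  refine ⟨κ, hκ, fun v w hv hw ↦ ?_⟩
  have hN := hl.inner_time_ne_zero hy τ
  have hs := hl.smoothFieldAt hy
  have hY : SmoothFieldAt (fun z ↦ D l z (l z)) y := hD.smoothFieldAt_conn hs hs
  have hNs := smoothFieldAt_extend (τ.field y)
  have hWs := smoothFieldAt_extend w
  have s1 := g.smoothFunAt_inner hs hNs
  have s2 := g.smoothFunAt_inner hY hWs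
  have s3 := g.smoothFunAt_inner hY hNs
  have s4 := g.smoothFunAt_inner hs hWs
  have s5 := ContMDiffAt.mul s1 s2
  have s6 := ContMDiffAt.mul s3 s4
  have h1 := hl.mvfderiv_eq_zero hy τ hψ (ContMDiffAt.sub s5 s6) (fun z hz ↦ by
    obtain ⟨κ', hκ'⟩ := hl.exists_conn_self_eq_smul hz hD τ hψ
    simp only [Pi.mul_apply, hκ', map_smul, _root_.smul_apply, smul_eq_mul]
    ring) hv
  rw [mvfderiv_fun_sub (SmoothFunAt.mdifferentiableAt s5) (SmoothFunAt.mdifferentiableAt s6),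
    mvfderiv_mul s1.mdifferentiableAt s2.mdifferentiableAt,
    mvfderiv_mul s3.mdifferentiableAt s4.mdifferentiableAt] at h1
  simp only [_root_.sub_apply, _root_.add_apply, _root_.smul_apply, smul_eq_mul,
    hD.mvfderiv_inner hs.diffFieldAt hNs.diffFieldAt,
    hD.mvfderiv_inner hs.diffFieldAt hWs.diffFieldAt,
    hD.mvfderiv_inner hY.diffFieldAt hNs.diffFieldAt,
    hD.mvfderiv_inner hY.diffFieldAt hWs.diffFieldAt,
    FiberBundle.extend_apply_self, hκ, map_smul, hw, mul_zero, zero_mul, add_zero] at h1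
  refine mul_left_cancel₀ hN ?_
  linear_combination h1

end NullNormal

variable (hψ : IsNonExpandingHorizon g τ D T ψ) (hl : IsNullNormal g ψ l) (hy : y ∈ Set.range ψ)
include hψ hl hy

theorem IsNonExpandingHorizon.trace_eq_zero {n e f : TangentSpace (𝓡 4) y}
    (hF : IsNullFrame g y (l y) n e f) :
    g.inner y (D l y e) e * g.inner y f f + g.inner y (D l y f) f * g.inner y e e -
      g.inner y e f * (g.inner y (D l y e) f + g.inner y (D l y f) e) = 0 := by
  refine trace_eq_zero_of_expansion (hl.ne_zero hy) hF fun k m h ↦ ?_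
  obtain ⟨p, rfl⟩ := hy
  exact hψ.nonexpanding l hl p k m h

/-- Since `l` is null, Einstein's equations give `Ric(l,l) = 8π T(l,l)`. This is a multiple of the
product of `l` with the vector `T^a_b l^b`, and future pointing causal vectors have nonnegative
product. -/
theorem IsNonExpandingHorizon.ricci_nonneg : 0 ≤ ricci D y (l y) (l y) := by
  have hll := hl.inner_self hy
  obtain ⟨p, rfl⟩ := hy
  have hein := hψ.einstein p (l (ψ p)) (l (ψ p))
  rw [hll, mul_zero, sub_zero] at hein
  rw [hein]
  have hfd : FiniteDimensional ℝ (TangentSpace (𝓡 4) (ψ p)) := .of_basis (coordBasis _)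
  have key : ∀ u, IsNullNormalAt g ψ p u → τ.FuturePointing u → 0 ≤ T (ψ p) u u := by
    intro u hu hfu
    -- Lowering an index is injective, hence onto the dual space, so the vector `T^a_b u^b` exists.
    have hinj : Function.Injective (ContinuousLinearMap.coeLM ℝ ∘ₗ (g.inner (ψ p)).toLinearMap) := by
      rw [injective_iff_map_eq_zero]
      intro w hw
      exact g.eq_zero_of_forall fun v ↦ congr($hw v)
    obtain ⟨w, hw⟩ := (LinearMap.injective_iff_surjective_of_finrank_eq_finrank
      Subspace.dual_finrank_eq.symm).1 hinj ((ContinuousLinearMap.coeLM ℝ ∘ₗ (T (ψ p)).toLinearMap).flip u)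
    have hw' : ∀ v, g.inner (ψ p) w v = T (ψ p) v u := fun v ↦ congr($hw v)
    rw [← hw']
    rcases hψ.energy p u hu hfu w hw' with rfl | h
    · simp
    · exact g.inner_nonneg_of_causal (τ.timelike _) h.1 hfu.1 h.2 hfu.2
  have hpos : 0 ≤ T (ψ p) (l (ψ p)) (l (ψ p)) := by
    have hN := hl.inner_time_ne_zero ⟨p, rfl⟩ τ
    rw [g.symm] at hN
    -- A past pointing `l` is replaced by `-l`, which leaves the quadratic expression unchanged.
    rcases lt_or_gt_of_ne hN with h | h
    · have h1 := key (-l (ψ p)) ⟨neg_ne_zero.2 (hl p).2.1, by simpa using hll, fun v ↦ by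
        simpa using (hl p).2.2.2 v⟩ ⟨by simp [hll], by simpa using h⟩
      simpa using h1
    · exact key _ (hl p).2 ⟨hll.ge, h⟩
  have := Real.pi_pos
  positivity

end Horizon
end NEH

/-! ### Real analysis and algebra of two-by-two forms -/

section Real

/-- A solution of a homogeneous linear differential equation which vanishes somewhere vanishes. -/
theorem eq_zero_of_hasDerivWithinAt_mul_self {a b t₀ : ℝ} {f K : ℝ → ℝ}
    (hK : ContinuousOn K (Set.Icc a b))
    (hf : ∀ t ∈ Set.Icc a b, HasDerivWithinAt f (K t * f t) (Set.Icc a b) t)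
    (ht₀ : t₀ ∈ Set.Icc a b) (h0 : f t₀ = 0) : ∀ t ∈ Set.Icc a b, f t = 0 := by
  obtain ⟨C, hC⟩ := isCompact_Icc.exists_bound_of_continuousOn hK
  -- With `|K| ≤ C`, the weight `c = 2C` makes this function increasing and `c = -2C` makes it
  -- decreasing. The first controls times before `t₀`, the second those after.
  have hd : ∀ (c : ℝ), ∀ t ∈ Set.Icc a b, HasDerivWithinAt (fun t ↦ f t ^ 2 * Real.exp (c * t))
      ((2 * K t + c) * (f t ^ 2 * Real.exp (c * t))) (Set.Icc a b) t := by
    intro c t ht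
    have h1 := ((hf t ht).pow 2).mul (((hasDerivAt_id t).const_mul c).exp.hasDerivWithinAt)
    refine h1.congr_deriv ?_
    simp
    ring
  have hi : ∀ (c : ℝ), ∀ t ∈ interior (Set.Icc a b), HasDerivAt (fun t ↦ f t ^ 2 * Real.exp (c * t))
      ((2 * K t + c) * (f t ^ 2 * Real.exp (c * t))) t := fun c t ht ↦
    (hd c t (interior_subset ht)).hasDerivAt (mem_interior_iff_mem_nhds.1 ht)
  have hmono : MonotoneOn (fun t ↦ f t ^ 2 * Real.exp (2 * C * t)) (Set.Icc a b) := by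
    refine monotoneOn_of_deriv_nonneg (convex_Icc a b)
      (fun t ht ↦ (hd _ t ht).continuousWithinAt)
      (fun t ht ↦ (hi _ t ht).differentiableAt.differentiableWithinAt) fun t ht ↦ ?_
    rw [(hi _ t ht).deriv]
    have := abs_le.1 (hC t (interior_subset ht))
    exact mul_nonneg (by linarith) (by positivity)
  have hanti : AntitoneOn (fun t ↦ f t ^ 2 * Real.exp (-(2 * C) * t)) (Set.Icc a b) := by
    refine antitoneOn_of_deriv_nonpos (convex_Icc a b)
      (fun t ht ↦ (hd _ t ht).continuousWithinAt)
      (fun t ht ↦ (hi _ t ht).differentiableAt.differentiableWithinAt) fun t ht ↦ ?_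
    rw [(hi _ t ht).deriv]
    have := abs_le.1 (hC t (interior_subset ht))
    exact mul_nonpos_of_nonpos_of_nonneg (by linarith) (by positivity)
  have hz : ∀ t c : ℝ, f t ^ 2 * Real.exp c ≤ 0 → f t = 0 := by
    intro t c h
    have h1 := Real.exp_pos c
    have h2 : f t ^ 2 ≤ 0 := by
      by_contra h3
      exact absurd (mul_pos (not_le.1 h3) h1) (not_lt.2 h)
    exact pow_eq_zero_iff (two_ne_zero) |>.1 (le_antisymm h2 (sq_nonneg _))
  intro t ht
  rcases le_total t t₀ with h | h
  · exact hz t (2 * C * t) (by simpa [h0] using hmono ht ht₀ h)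
  · exact hz t (-(2 * C) * t) (by simpa [h0] using hanti ht₀ ht h)

theorem eq_of_hasDerivWithinAt_zero {a b t₀ : ℝ} {f : ℝ → ℝ}
    (hf : ∀ t ∈ Set.Icc a b, HasDerivWithinAt f 0 (Set.Icc a b) t)
    (ht₀ : t₀ ∈ Set.Icc a b) : ∀ t ∈ Set.Icc a b, f t = f t₀ := fun t ht ↦
  sub_eq_zero.1 <| eq_zero_of_hasDerivWithinAt_mul_self (f := fun t ↦ f t - f t₀)
    (K := fun _ ↦ 0) continuousOn_const
    (fun t ht ↦ ((hf t ht).sub_const (f t₀)).congr_deriv (by simp)) ht₀ (sub_self _) t ht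

/-- A symmetric form of nonnegative determinant which is trace-free with respect to a definite
form vanishes. -/
theorem symm_form_eq_zero {p r s a b c : ℝ} (hq : 0 < p * r - s ^ 2)
    (htr : a * r + b * p - 2 * s * c = 0) (hdet : 0 ≤ a * b - c ^ 2) :
    a = 0 ∧ b = 0 ∧ c = 0 := by
  have h1 : (a * r + b * p) ^ 2 = 4 * s ^ 2 * c ^ 2 := by
    rw [show a * r + b * p = 2 * s * c by linarith]
    ring
  -- Trace-freeness gives `4abpr ≤ (ar + bp)² = 4s²c² ≤ 4s²ab`.
  have h2 : a * b * (p * r - s ^ 2) ≤ 0 := by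
    nlinarith [sq_nonneg (a * r - b * p), mul_nonneg (sq_nonneg s) hdet]
  have h3 : a * b ≤ 0 := by
    by_contra h
    exact absurd (mul_pos (not_le.1 h) hq) (not_lt.2 h2)
  have hc : c = 0 := by
    have : c ^ 2 ≤ 0 := by linarith
    exact pow_eq_zero_iff two_ne_zero |>.1 (le_antisymm this (sq_nonneg _))
  have hab : a * b = 0 := by
    rw [hc] at hdet
    linarith
  have hpr : p * r ≠ 0 := by nlinarith [sq_nonneg s]
  rw [hc, mul_zero, sub_zero] at htr
  rcases mul_eq_zero.1 hab with h | h
  · rw [h, zero_mul, zero_add] at htr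
    exact ⟨h, (mul_eq_zero.1 htr).resolve_right (left_ne_zero_of_mul hpr), hc⟩
  · rw [h, zero_mul, add_zero] at htr
    exact ⟨(mul_eq_zero.1 htr).resolve_right (right_ne_zero_of_mul hpr), h, hc⟩

/-- Cayley-Hamilton in dimension two: a trace-free endomorphism has `B² = -det B`, so `tr B² = -2
det B`. Here `p, s, r` is the Gram matrix, `a, c, b` the form of `B`, and `x₁, x₃, x₄, x₂` the
products of the images. -/
theorem quadratic_form_of_tracefree {p r s a b c x₁ x₂ x₃ x₄ : ℝ} (hq : p * r - s ^ 2 ≠ 0)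
    (htr : a * r + b * p - s * (c + c) = 0)
    (h1 : x₁ * (p * r - s ^ 2) = a * (r * a - s * c) + c * (p * c - s * a))
    (h2 : x₃ * (p * r - s ^ 2) = a * (r * c - s * b) + c * (p * b - s * c))
    (h3 : x₄ * (p * r - s ^ 2) = c * (r * a - s * c) + b * (p * c - s * a))
    (h4 : x₂ * (p * r - s ^ 2) = c * (r * c - s * b) + b * (p * b - s * c)) :
    x₁ * r + x₂ * p - s * (x₃ + x₄) = -2 * (a * b - c ^ 2) := by
  refine mul_right_cancel₀ hq ?_
  linear_combination r * h1 + p * h4 - s * h2 - s * h3 + (a * r + b * p - 2 * s * c) * htr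

end Real

/-! ### Evolution of the geometry along `l`; the Raychaudhuri equation -/

namespace NEH
open Filter Topology Bundle

section Dragging

variable {M : Type*} [TopologicalSpace M] [ChartedSpace E4 M] [IsManifold (𝓡 4) ∞ M]
  {g : LorentzMetric M} {τ : TimeOrientation g} {D : Connection M} {T : TwoTensor M}
  {ψ : ℝ × S2 → M} {l e f : VField M} {y : M}

omit [IsManifold (𝓡 4) ∞ M] in
theorem mvfderiv_mul_add_mul_sub {a₁ a₂ a₃ a₄ a₅ a₆ a₇ : M → ℝ}
    (h₁ : MDifferentiableAt (𝓡 4) 𝓘(ℝ, ℝ) a₁ y) (h₂ : MDifferentiableAt (𝓡 4) 𝓘(ℝ, ℝ) a₂ y)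
    (h₃ : MDifferentiableAt (𝓡 4) 𝓘(ℝ, ℝ) a₃ y) (h₄ : MDifferentiableAt (𝓡 4) 𝓘(ℝ, ℝ) a₄ y)
    (h₅ : MDifferentiableAt (𝓡 4) 𝓘(ℝ, ℝ) a₅ y) (h₆ : MDifferentiableAt (𝓡 4) 𝓘(ℝ, ℝ) a₆ y)
    (h₇ : MDifferentiableAt (𝓡 4) 𝓘(ℝ, ℝ) a₇ y) (u : TangentSpace (𝓡 4) y) :
    mvfderiv (𝓡 4) (fun z ↦ a₁ z * a₆ z + a₂ z * a₅ z - a₇ z * (a₃ z + a₄ z)) y u =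
      a₁ y * mvfderiv (𝓡 4) a₆ y u + a₆ y * mvfderiv (𝓡 4) a₁ y u +
      (a₂ y * mvfderiv (𝓡 4) a₅ y u + a₅ y * mvfderiv (𝓡 4) a₂ y u) -
      (a₇ y * (mvfderiv (𝓡 4) a₃ y u + mvfderiv (𝓡 4) a₄ y u) +
        (a₃ y + a₄ y) * mvfderiv (𝓡 4) a₇ y u) := by
  have e : (fun z ↦ a₁ z * a₆ z + a₂ z * a₅ z - a₇ z * (a₃ z + a₄ z)) =
      a₁ * a₆ + a₂ * a₅ - a₇ * (a₃ + a₄) := rfl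
  rw [e, mvfderiv_sub ((h₁.mul h₆).add (h₂.mul h₅)) (h₇.mul (h₃.add h₄)),
    mvfderiv_add (h₁.mul h₆) (h₂.mul h₅), mvfderiv_mul h₁ h₆, mvfderiv_mul h₂ h₅,
    mvfderiv_mul h₇ (h₃.add h₄), mvfderiv_add h₃ h₄]
  rfl

theorem IsNullFrame.inner_image {n e f l : TangentSpace (𝓡 4) y} (hF : IsNullFrame g y l n e f)
    {B : TangentSpace (𝓡 4) y →L[ℝ] TangentSpace (𝓡 4) y} (he : g.inner y (B e) l = 0)
    (hf : g.inner y (B f) l = 0) (hs : g.inner y (B e) f = g.inner y (B f) e)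
    (htr : g.inner y (B e) e * g.inner y f f + g.inner y (B f) f * g.inner y e e -
      g.inner y e f * (g.inner y (B e) f + g.inner y (B f) e) = 0) :
    g.inner y (B e) (B e) * g.inner y f f + g.inner y (B f) (B f) * g.inner y e e -
      g.inner y e f * (g.inner y (B e) (B f) + g.inner y (B f) (B e)) =
    -2 * (g.inner y (B e) e * g.inner y (B f) f - g.inner y (B e) f ^ 2) := by
  have hq := hF.det
  -- Modulo `l`, vectors of `l^⊥` lie in the plane of `e` and `f`, and the `l` component contributes
  -- nothing to products within `l^⊥`.
  have key : ∀ u v, g.inner y u l = 0 → g.inner y v l = 0 →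
      g.inner y u v * (g.inner y e e * g.inner y f f - g.inner y e f ^ 2) =
        g.inner y u e * (g.inner y f f * g.inner y v e - g.inner y e f * g.inner y v f) +
        g.inner y u f * (g.inner y e e * g.inner y v f - g.inner y e f * g.inner y v e) := by
    intro u v hu hv
    conv_lhs => rw [hF.eq_combination v]
    simp only [map_add, map_smul, smul_eq_mul, hu, hv]
    generalize hq' : g.inner y e e * g.inner y f f - g.inner y e f ^ 2 = q at hq ⊢
    field_simp
    ring
  have h1 := key _ _ he he
  have h2 := key _ _ he hf
  have h3 := key _ _ hf he
  have h4 := key _ _ hf hf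
  rw [← hs] at h2 h3 h4 htr
  exact quadratic_form_of_tracefree hq htr h1 h2 h3 h4

section Pointwise

variable (hl : IsNullNormal g ψ l) (hy : y ∈ Set.range ψ) (hD : IsLeviCivita g D)
  (hes : SmoothFieldAt e y) (he : VectorField.mlieBracket (𝓡 4) l e y = 0)
  (hfs : SmoothFieldAt f y) (hf : VectorField.mlieBracket (𝓡 4) l f y = 0)
include hl hy hD hes he

theorem IsNullNormal.conn_dragged : D e y (l y) = D l y (e y) := by
  have h := hD.torsion_free l e y (hl.smoothFieldAt hy).diffFieldAt hes.diffFieldAt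
  rw [he] at h
  exact sub_eq_zero.1 h

theorem IsNullNormal.mvfderiv_inner_dragged :
    mvfderiv (𝓡 4) (fun z ↦ g.inner z (l z) (e z)) y (l y) =
      g.inner y (D l y (l y)) (e y) + g.inner y (l y) (D l y (e y)) := by
  rw [hD.mvfderiv_inner (hl.smoothFieldAt hy).diffFieldAt hes.diffFieldAt,
    hl.conn_dragged hy hD hes he]

include hfs hf

theorem IsNullNormal.mvfderiv_inner_dragged_dragged :
    mvfderiv (𝓡 4) (fun z ↦ g.inner z (e z) (f z)) y (l y) =
      g.inner y (D l y (e y)) (f y) + g.inner y (D l y (f y)) (e y) := by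
  rw [hD.mvfderiv_inner hes.diffFieldAt hfs.diffFieldAt,
    hl.conn_dragged hy hD hes he, hl.conn_dragged hy hD hfs hf, g.symm y (e y)]

/-- Since `[l,e] = 0`, the definition of curvature gives `∇_l ∇_e l = ∇_e ∇_l l - R(e,l)l`. -/
theorem IsNullNormal.mvfderiv_shape [T2Space M] :
    mvfderiv (𝓡 4) (fun z ↦ g.inner z (D l z (e z)) (f z)) y (l y) =
      g.inner y (D (fun z ↦ D l z (l z)) y (e y)) (f y) +
        g.inner y (D l y (e y)) (D l y (f y)) -
        g.inner y (riemann D y (e y) (l y) (l y)) (f y) := by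
  have hs := hl.smoothFieldAt hy
  have h1 := riemann_eq_curvatureField hD hes hs hs
  rw [curvatureField, VectorField.mlieBracket_swap_apply, he, neg_zero, map_zero, sub_zero] at h1
  rw [hD.mvfderiv_inner (hD.smoothFieldAt_conn hs hes).diffFieldAt hfs.diffFieldAt,
    hl.conn_dragged hy hD hfs hf, h1, map_sub, _root_.sub_apply]
  ring

end Pointwise

theorem riemann_self_left (D : Connection M) (u w : TangentSpace (𝓡 4) y) :
    riemann D y u u w = 0 := by
  have h : riemann D y u u w = - riemann D y u u w := curvatureField_swap D
  have h2 : (2 : ℝ) • riemann D y u u w = 0 := by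
    rw [two_smul]
    nth_rewrite 1 [h]
    exact neg_add_cancel _
  exact (smul_eq_zero.1 h2).resolve_left two_ne_zero

/-- The `l` and `n` terms of the trace drop out by `R(l,l)l = 0` and `g(R(n,l)l, l) = 0`, so only
the plane of `e` and `f` contributes. -/
theorem IsNullFrame.ricci_eq [T2Space M] (hD : IsLeviCivita g D)
    {l n e f : TangentSpace (𝓡 4) y} (hF : IsNullFrame g y l n e f) :
    (g.inner y e e * g.inner y f f - g.inner y e f ^ 2) * ricci D y l l =
      g.inner y (riemann D y e l l) e * g.inner y f f +
        g.inner y (riemann D y f l l) f * g.inner y e e -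
        g.inner y e f * (g.inner y (riemann D y e l l) f + g.inner y (riemann D y f l l) e) := by
  rw [ricci_eq_trace hD, hF.trace_eq]
  change _ * (g.inner y (riemann D y l l l) n + g.inner y (riemann D y n l l) l) +
    (g.inner y f f * g.inner y (riemann D y e l l) e +
      g.inner y e e * g.inner y (riemann D y f l l) f -
      g.inner y e f * (g.inner y (riemann D y e l l) f + g.inner y (riemann D y f l l) e)) = _
  rw [riemann_self_left, inner_riemann_self hD]
  simp only [map_zero, _root_.zero_apply]
  ring

/-- The derivative along the null normal of the trace of the second fundamental form, for vanishing
expansion: the Raychaudhuri equation. -/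
theorem IsNonExpandingHorizon.mvfderiv_trace [T2Space M] (hψ : IsNonExpandingHorizon g τ D T ψ)
    (hl : IsNullNormal g ψ l) (hy : y ∈ Set.range ψ) (hD : IsLeviCivita g D)
    (hes : SmoothFieldAt e y) (he : VectorField.mlieBracket (𝓡 4) l e y = 0)
    (hfs : SmoothFieldAt f y) (hf : VectorField.mlieBracket (𝓡 4) l f y = 0)
    (hle : g.inner y (l y) (e y) = 0) (hlf : g.inner y (l y) (f y) = 0)
    (hq : g.inner y (e y) (e y) * g.inner y (f y) (f y) - g.inner y (e y) (f y) ^ 2 ≠ 0) :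
    mvfderiv (𝓡 4) (fun z ↦ g.inner z (D l z (e z)) (e z) * g.inner z (f z) (f z) +
      g.inner z (D l z (f z)) (f z) * g.inner z (e z) (e z) -
      g.inner z (e z) (f z) * (g.inner z (D l z (e z)) (f z) + g.inner z (D l z (f z)) (e z)))
      y (l y) =
    2 * (g.inner y (D l y (e y)) (e y) * g.inner y (D l y (f y)) (f y) -
      g.inner y (D l y (e y)) (f y) ^ 2) -
    (g.inner y (e y) (e y) * g.inner y (f y) (f y) - g.inner y (e y) (f y) ^ 2) *
      ricci D y (l y) (l y) := by
  have hs := hl.smoothFieldAt hy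
  obtain ⟨n, hF⟩ := exists_isNullFrame (hl.inner_time_ne_zero hy τ) (hl.inner_self hy) hle hlf hq
  obtain ⟨κ, -, hκ⟩ := hl.exists_inner_conn_conn hy hD τ hψ.embedding
  have hsymm := hl.inner_conn_symm hy hD τ hψ.embedding hle hlf
  have htr := hψ.trace_eq_zero hl hy hF
  have h1 := hF.inner_image (hl.inner_conn_self hy hD τ hψ.embedding hle)
    (hl.inner_conn_self hy hD τ hψ.embedding hlf) hsymm htr
  have hBe := hD.smoothFieldAt_conn hs hes
  have hBf := hD.smoothFieldAt_conn hs hfs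
  have a1 := (g.smoothFunAt_inner hBe hes).mdifferentiableAt
  have a2 := (g.smoothFunAt_inner hBf hfs).mdifferentiableAt
  have a3 := (g.smoothFunAt_inner hBe hfs).mdifferentiableAt
  have a4 := (g.smoothFunAt_inner hBf hes).mdifferentiableAt
  have a5 := (g.smoothFunAt_inner hes hes).mdifferentiableAt
  have a6 := (g.smoothFunAt_inner hfs hfs).mdifferentiableAt
  have a7 := (g.smoothFunAt_inner hes hfs).mdifferentiableAt
  refine (mvfderiv_mul_add_mul_sub a1 a2 a3 a4 a5 a6 a7 (l y)).trans ?_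
  simp only [
    hl.mvfderiv_inner_dragged_dragged hy hD hes he hes he,
    hl.mvfderiv_inner_dragged_dragged hy hD hes he hfs hf,
    hl.mvfderiv_inner_dragged_dragged hy hD hfs hf hfs hf,
    hl.mvfderiv_shape hy hD hes he hes he, hl.mvfderiv_shape hy hD hes he hfs hf,
    hl.mvfderiv_shape hy hD hfs hf hes he, hl.mvfderiv_shape hy hD hfs hf hfs hf,
    hκ _ _ hle hle, hκ _ _ hle hlf, hκ _ _ hlf hle, hκ _ _ hlf hlf, hF.ricci_eq hD]
  rw [← hsymm] at htr ⊢
  -- Differentiating the metric factors contributes `4 det B`, the squared shape term `-2 det B`,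
  -- and the `κ` term is a multiple of the vanishing trace.
  linear_combination h1 + κ * htr

end Dragging
end NEH

/-! ### Transport along a generator -/

namespace NEH
open Filter Topology Bundle

section Generator

variable {M : Type*} [TopologicalSpace M] [ChartedSpace E4 M] [IsManifold (𝓡 4) ∞ M]
  {g : LorentzMetric M} {τ : TimeOrientation g} {D : Connection M} {T : TwoTensor M}
  {ψ : ℝ × S2 → M} {l e f : VField M} {γ : ℝ → M} {s : Set ℝ} {a b t : ℝ}

omit [IsManifold (𝓡 4) ∞ M] in
theorem hasDerivWithinAt_comp_integralCurve {F : M → ℝ} (hγ : IsMIntegralCurveOn γ l s)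
    (ht : t ∈ s) (hF : MDifferentiableAt (𝓡 4) 𝓘(ℝ, ℝ) F (γ t)) :
    HasDerivWithinAt (fun t ↦ F (γ t)) (mvfderiv (𝓡 4) F (γ t) (l (γ t))) s t := by
  let L : ℝ →L[ℝ] ℝ := (mvfderiv (𝓡 4) F (γ t)).comp
    ((1 : ℝ →L[ℝ] ℝ).smulRight (l (γ t)))
  have h : HasFDerivWithinAt (fun t ↦ F (γ t)) L s t :=
    (hF.hasMFDerivAt.comp_hasMFDerivWithinAt t (hγ t ht)).hasFDerivWithinAt
  refine h.hasDerivWithinAt.congr_deriv ?_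
  change mvfderiv (𝓡 4) F (γ t) ((1 : ℝ) • l (γ t)) = _
  rw [one_smul]

/-- A field along the curve `γ` which is Lie dragged by `l`. -/
def IsDraggedAlong (l e : VField M) (γ : ℝ → M) (s : Set ℝ) : Prop :=
  ∀ t ∈ s, SmoothFieldAt e (γ t) ∧ VectorField.mlieBracket (𝓡 4) l e (γ t) = 0

section Normal

variable (hl : IsNullNormal g ψ l) (hD : IsLeviCivita g D)
  (hγ : IsMIntegralCurveOn γ l (Set.Icc a b)) (hH : ∀ t ∈ Set.Icc a b, γ t ∈ Set.range ψ)
  (he : IsDraggedAlong l e γ (Set.Icc a b))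
include hl hD hγ hH he

/-- Lie dragging along the null generators preserves orthogonality to the null normal. -/
theorem IsNullNormal.inner_dragged_eq_zero [T2Space M] (τ : TimeOrientation g)
    (hψ : Manifold.IsSmoothEmbedding (𝓘(ℝ, ℝ).prod (𝓡 2)) (𝓡 4) ∞ ψ)
    {t₀ : ℝ} (ht₀ : t₀ ∈ Set.Icc a b) (h0 : g.inner (γ t₀) (l (γ t₀)) (e (γ t₀)) = 0) :
    ∀ t ∈ Set.Icc a b, g.inner (γ t) (l (γ t)) (e (γ t)) = 0 := by
  have hex : ∀ t, ∃ K : ℝ, t ∈ Set.Icc a b → ∀ v, g.inner (γ t) (D l (γ t) (l (γ t))) v +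
      g.inner (γ t) (l (γ t)) (D l (γ t) v) = K * g.inner (γ t) (l (γ t)) v := by
    intro t
    by_cases ht : t ∈ Set.Icc a b
    · obtain ⟨K, hK⟩ := hl.exists_inner_conn_add (hH t ht) hD τ hψ
      exact ⟨K, fun _ ↦ hK⟩
    · exact ⟨0, fun h ↦ absurd h ht⟩
  choose K hK using hex
  -- `K` was chosen point by point, so its continuity needs proof. Near `t` it is a quotient of
  -- smooth functions, found by evaluating both forms on a fixed local extension of the timelike
  -- vector.
  refine eq_zero_of_hasDerivWithinAt_mul_self (K := K) (fun t ht ↦ ?_) (fun t ht ↦ ?_) ht₀ h0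
  · have hs := hl.smoothFieldAt (hH t ht)
    have hN := smoothFieldAt_extend (τ.field (γ t))
    have hγc : ContinuousWithinAt γ (Set.Icc a b) t := (hγ t ht).continuousWithinAt
    have c1 := (g.smoothFunAt_inner (hD.smoothFieldAt_conn hs hs) hN).continuousAt
    have c2 := (g.smoothFunAt_inner hs (hD.smoothFieldAt_conn hs hN)).continuousAt
    have c3 := (g.smoothFunAt_inner hs hN).continuousAt
    have hne : g.inner (γ t) (l (γ t)) (FiberBundle.extend E4 (τ.field (γ t)) (γ t)) ≠ 0 := by
      rw [FiberBundle.extend_apply_self]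
      exact hl.inner_time_ne_zero (hH t ht) τ
    have c4 := ((c1.add c2).div c3 hne).comp_continuousWithinAt hγc
    have hev : ∀ᶠ r in 𝓝[Set.Icc a b] t, g.inner (γ r) (l (γ r))
        (FiberBundle.extend E4 (τ.field (γ t)) (γ r)) ≠ 0 :=
      hγc.eventually (c3.eventually_ne hne)
    have hform : ∀ r ∈ Set.Icc a b, g.inner (γ r) (l (γ r))
        (FiberBundle.extend E4 (τ.field (γ t)) (γ r)) ≠ 0 → K r =
        (g.inner (γ r) (D l (γ r) (l (γ r))) (FiberBundle.extend E4 (τ.field (γ t)) (γ r)) +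
          g.inner (γ r) (l (γ r)) (D l (γ r) (FiberBundle.extend E4 (τ.field (γ t)) (γ r)))) /
        g.inner (γ r) (l (γ r)) (FiberBundle.extend E4 (τ.field (γ t)) (γ r)) := by
      intro r hr h
      rw [hK r hr, mul_div_cancel_right₀ _ h]
    refine c4.congr_of_eventuallyEq ?_ (hform t ht hne)
    filter_upwards [hev, self_mem_nhdsWithin] with r h1 h2
    exact hform r h2 h1
  · have h1 := hasDerivWithinAt_comp_integralCurve hγ ht
      (g.smoothFunAt_inner (hl.smoothFieldAt (hH t ht)) (he t ht).1).mdifferentiableAt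
    rwa [hl.mvfderiv_inner_dragged (hH t ht) hD (he t ht).1 (he t ht).2, hK t ht] at h1

theorem IsNullNormal.hasDerivWithinAt_inner_dragged (hf : IsDraggedAlong l f γ (Set.Icc a b))
    (ht : t ∈ Set.Icc a b) :
    HasDerivWithinAt (fun t ↦ g.inner (γ t) (e (γ t)) (f (γ t)))
      (g.inner (γ t) (D l (γ t) (e (γ t))) (f (γ t)) +
        g.inner (γ t) (D l (γ t) (f (γ t))) (e (γ t))) (Set.Icc a b) t := by
  have h1 := hasDerivWithinAt_comp_integralCurve hγ ht
    (g.smoothFunAt_inner (he t ht).1 (hf t ht).1).mdifferentiableAt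
  rwa [hl.mvfderiv_inner_dragged_dragged (hH t ht) hD (he t ht).1 (he t ht).2 (hf t ht).1
    (hf t ht).2] at h1

end Normal

/-- On a non-expanding horizon, Lie dragging along the null generators preserves the metric on
planes orthogonal to the null normal. -/
theorem IsNonExpandingHorizon.inner_dragged_eq [T2Space M] (hψ : IsNonExpandingHorizon g τ D T ψ)
    (hl : IsNullNormal g ψ l) (hD : IsLeviCivita g D)
    (hγ : IsMIntegralCurveOn γ l (Set.Icc a b)) (hH : ∀ t ∈ Set.Icc a b, γ t ∈ Set.range ψ)
    (he : IsDraggedAlong l e γ (Set.Icc a b)) (hf : IsDraggedAlong l f γ (Set.Icc a b))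
    {t₀ : ℝ} (ht₀ : t₀ ∈ Set.Icc a b)
    (hle : ∀ t ∈ Set.Icc a b, g.inner (γ t) (l (γ t)) (e (γ t)) = 0)
    (hlf : ∀ t ∈ Set.Icc a b, g.inner (γ t) (l (γ t)) (f (γ t)) = 0)
    (hq : g.inner (γ t₀) (e (γ t₀)) (e (γ t₀)) * g.inner (γ t₀) (f (γ t₀)) (f (γ t₀)) -
      g.inner (γ t₀) (e (γ t₀)) (f (γ t₀)) ^ 2 ≠ 0) :
    ∀ t ∈ Set.Icc a b,
      g.inner (γ t) (e (γ t)) (e (γ t)) = g.inner (γ t₀) (e (γ t₀)) (e (γ t₀)) ∧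
      g.inner (γ t) (f (γ t)) (f (γ t)) = g.inner (γ t₀) (f (γ t₀)) (f (γ t₀)) ∧
      g.inner (γ t) (e (γ t)) (f (γ t)) = g.inner (γ t₀) (e (γ t₀)) (f (γ t₀)) := by
  have hsymm : ∀ t ∈ Set.Icc a b, g.inner (γ t) (D l (γ t) (e (γ t))) (f (γ t)) =
      g.inner (γ t) (D l (γ t) (f (γ t))) (e (γ t)) := fun t ht ↦
    hl.inner_conn_symm (hH t ht) hD τ hψ.embedding (hle t ht) (hlf t ht)
  have dee := fun t ht ↦ hl.hasDerivWithinAt_inner_dragged hD hγ hH he he (t := t) ht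
  have dff := fun t ht ↦ hl.hasDerivWithinAt_inner_dragged hD hγ hH hf hf (t := t) ht
  have def' := fun t ht ↦ hl.hasDerivWithinAt_inner_dragged hD hγ hH he hf (t := t) ht
  have htr : ∀ t ∈ Set.Icc a b, g.inner (γ t) (e (γ t)) (e (γ t)) *
      g.inner (γ t) (f (γ t)) (f (γ t)) - g.inner (γ t) (e (γ t)) (f (γ t)) ^ 2 ≠ 0 →
      g.inner (γ t) (D l (γ t) (e (γ t))) (e (γ t)) * g.inner (γ t) (f (γ t)) (f (γ t)) +
      g.inner (γ t) (D l (γ t) (f (γ t))) (f (γ t)) * g.inner (γ t) (e (γ t)) (e (γ t)) -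
      g.inner (γ t) (e (γ t)) (f (γ t)) * (g.inner (γ t) (D l (γ t) (e (γ t))) (f (γ t)) +
        g.inner (γ t) (D l (γ t) (f (γ t))) (e (γ t))) = 0 := by
    intro t ht h
    obtain ⟨n, hF⟩ := exists_isNullFrame (hl.inner_time_ne_zero (hH t ht) τ)
      (hl.inner_self (hH t ht)) (hle t ht) (hlf t ht) h
    exact hψ.trace_eq_zero hl (hH t ht) hF
  -- The Gram determinant `q` has derivative twice the trace, but the trace is known to vanish only
  -- where `q ≠ 0`. The derivative of `q²` has the extra factor `q` and vanishes in either case, so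
  -- `q` never becomes zero.
  have hdet2 : ∀ t ∈ Set.Icc a b, (g.inner (γ t) (e (γ t)) (e (γ t)) *
      g.inner (γ t) (f (γ t)) (f (γ t)) - g.inner (γ t) (e (γ t)) (f (γ t)) ^ 2) ^ 2 =
      (g.inner (γ t₀) (e (γ t₀)) (e (γ t₀)) * g.inner (γ t₀) (f (γ t₀)) (f (γ t₀)) -
      g.inner (γ t₀) (e (γ t₀)) (f (γ t₀)) ^ 2) ^ 2 := by
    refine eq_of_hasDerivWithinAt_zero (f := fun t ↦ (g.inner (γ t) (e (γ t)) (e (γ t)) *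
      g.inner (γ t) (f (γ t)) (f (γ t)) - g.inner (γ t) (e (γ t)) (f (γ t)) ^ 2) ^ 2)
      (fun t ht ↦ ?_) ht₀
    refine ((((dee t ht).mul (dff t ht)).sub ((def' t ht).pow 2)).pow 2).congr_deriv ?_
    by_cases h : g.inner (γ t) (e (γ t)) (e (γ t)) *
      g.inner (γ t) (f (γ t)) (f (γ t)) - g.inner (γ t) (e (γ t)) (f (γ t)) ^ 2 = 0
    · simp [h]
    · simp only [Pi.sub_apply, Pi.mul_apply, Pi.pow_apply]
      have := htr t ht h
      push_cast
      linear_combination 4 * (g.inner (γ t) (e (γ t)) (e (γ t)) *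
        g.inner (γ t) (f (γ t)) (f (γ t)) - g.inner (γ t) (e (γ t)) (f (γ t)) ^ 2) * this
  have hne : ∀ t ∈ Set.Icc a b, g.inner (γ t) (e (γ t)) (e (γ t)) *
      g.inner (γ t) (f (γ t)) (f (γ t)) - g.inner (γ t) (e (γ t)) (f (γ t)) ^ 2 ≠ 0 := by
    intro t ht h
    have := hdet2 t ht
    rw [h, zero_pow two_ne_zero] at this
    exact pow_ne_zero 2 hq this.symm
  have hpos : ∀ t ∈ Set.Icc a b, 0 < g.inner (γ t) (e (γ t)) (e (γ t)) *
      g.inner (γ t) (f (γ t)) (f (γ t)) - g.inner (γ t) (e (γ t)) (f (γ t)) ^ 2 := by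
    intro t ht
    obtain ⟨n, hF⟩ := exists_isNullFrame (hl.inner_time_ne_zero (hH t ht) τ)
      (hl.inner_self (hH t ht)) (hle t ht) (hlf t ht) (hne t ht)
    exact hF.det_pos (hl.ne_zero (hH t ht))
  -- A one-point interval has no unique derivatives and is treated separately.
  rcases (ht₀.1.trans ht₀.2).eq_or_lt with hab | hab
  · intro t ht
    have : t = t₀ := by
      rw [← hab, Set.Icc_self] at ht ht₀
      exact ht.trans ht₀.symm
    subst this
    exact ⟨rfl, rfl, rfl⟩
  have hzero : ∀ t ∈ Set.Icc a b, g.inner (γ t) (D l (γ t) (e (γ t))) (e (γ t)) = 0 ∧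
      g.inner (γ t) (D l (γ t) (f (γ t))) (f (γ t)) = 0 ∧
      g.inner (γ t) (D l (γ t) (e (γ t))) (f (γ t)) = 0 := by
    intro t ht
    have hy := hH t ht
    have hs := hl.smoothFieldAt hy
    have hes := (he t ht).1
    have hfs := (hf t ht).1
    have hBe := hD.smoothFieldAt_conn hs hes
    have hBf := hD.smoothFieldAt_conn hs hfs
    have h1 := hasDerivWithinAt_comp_integralCurve hγ ht (SmoothFunAt.mdifferentiableAt
      ((ContMDiffAt.add ((g.smoothFunAt_inner hBe hes).mul (g.smoothFunAt_inner hfs hfs))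
        ((g.smoothFunAt_inner hBf hfs).mul (g.smoothFunAt_inner hes hes))).sub
        (ContMDiffAt.mul (g.smoothFunAt_inner hes hfs)
          (ContMDiffAt.add (g.smoothFunAt_inner hBe hfs) (g.smoothFunAt_inner hBf hes)))))
    have h2 := (hasDerivWithinAt_const t (Set.Icc a b) (0 : ℝ)).congr
      (fun t ht ↦ htr t ht (hne t ht)) (htr t ht (hne t ht))
    -- The trace vanishes along the whole arc, so its derivative is zero, and the Raychaudhuri
    -- equation then makes `det B` nonnegative.
    have h3 := (uniqueDiffOn_Icc hab t ht).eq_deriv _ h1 h2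
    have h4 := hψ.mvfderiv_trace hl hy hD hes (he t ht).2 hfs (hf t ht).2 (hle t ht) (hlf t ht)
      (hne t ht)
    have h5 := mul_nonneg (hpos t ht).le (hψ.ricci_nonneg hl hy)
    have h6 := htr t ht (hne t ht)
    rw [← hsymm t ht] at h6
    refine symm_form_eq_zero (hpos t ht) (by linarith) ?_
    have h7 := h4.symm.trans h3
    linarith
  intro t ht
  refine ⟨eq_of_hasDerivWithinAt_zero (fun t ht ↦ (dee t ht).congr_deriv ?_) ht₀ t ht,
    eq_of_hasDerivWithinAt_zero (fun t ht ↦ (dff t ht).congr_deriv ?_) ht₀ t ht,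
    eq_of_hasDerivWithinAt_zero (fun t ht ↦ (def' t ht).congr_deriv ?_) ht₀ t ht⟩
  · simp [(hzero t ht).1]
  · simp [(hzero t ht).2.1]
  · simp [← hsymm t ht, (hzero t ht).2.2]

end Generator
end NEH

/-! ### The main theorem -/

theorem mainTheorem2 {M : Type*} [TopologicalSpace M] [T2Space M] [ChartedSpace NEH.E4 M]
    [IsManifold (𝓡 4) ∞ M]
    -- the space-time, its Levi-Civita connection and its energy-momentum tensor
    (g : NEH.LorentzMetric M) (τ : NEH.TimeOrientation g)
    (D : NEH.Connection M) (hD : NEH.IsLeviCivita g D) (T : NEH.TwoTensor M)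
    -- the horizon, a null normal, and a spherical cut
    (ψ : ℝ × NEH.S2 → M) (hψ : NEH.IsNonExpandingHorizon g τ D T ψ)
    (l : Π x : M, TangentSpace (𝓡 4) x) (hl : NEH.IsNullNormal g ψ l)
    (s : NEH.S2 → M) (hs : NEH.IsSphericalCut (Set.range ψ) l s)
    -- the tetrad on an open piece of the cut
    (W : Set NEH.S2) (hW : IsOpen W)
    (n : Π x : M, TangentSpace (𝓡 4) x) (m : Π x : M, NEH.CVec (TangentSpace (𝓡 4) x))
    (htetrad : ∀ p ∈ W, NEH.IsNullTetrad g (s p) (l (s p)) (n (s p)) (m (s p)))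
    -- `m` is smooth and Lie dragged along the generators through that piece
    (hm : ∀ x ∈ NEH.sweptBy (Set.range ψ) l s W,
      NEH.SmoothFieldAt (NEH.reField m) x ∧ NEH.SmoothFieldAt (NEH.imField m) x)
    (hlie : ∀ x ∈ NEH.sweptBy (Set.range ψ) l s W, NEH.lieC l m x = ⟨0, 0⟩) :
    ∀ x ∈ NEH.sweptBy (Set.range ψ) l s W,
      NEH.CVec.bilin (g.inner x) (NEH.CVec.ofReal (l x)) (m x) = 0 ∧
      NEH.CVec.bilin (g.inner x) (m x) (m x) = 0 ∧
      NEH.CVec.bilin (g.inner x) (m x) (m x).conj = -1 ∧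
      (∃! k : TangentSpace (𝓡 4) x, NEH.IsNullTetrad g x (l x) k (m x)) ∧
      ∀ k : TangentSpace (𝓡 4) x, NEH.IsNullTetrad g x (l x) k (m x) →
        NEH.spinEpsilon g D l m x k - starRingEnd ℂ (NEH.spinEpsilon g D l m x k) = 0 := by
  rintro x ⟨-, p, hp, γ, a, b, hγa, hγb, hγ, hγH⟩
  -- The dragging hypotheses hold on the whole arc from the cut to `x`, because each of its points
  -- is reached from the cut by a subarc. The unordered interval covers `x` on either side of the
  -- cut.
  have hswept : ∀ t ∈ Set.uIcc a b, γ t ∈ NEH.sweptBy (Set.range ψ) l s W := fun t ht ↦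
    have hsub : Set.uIcc a t ⊆ Set.uIcc a b := Set.uIcc_subset_uIcc_left ht
    ⟨hγH t ht, p, hp, γ, a, t, hγa, rfl, hγ.mono hsub, fun r hr ↦ hγH r (hsub hr)⟩
  have he : NEH.IsDraggedAlong l (NEH.reField m) γ (Set.uIcc a b) := fun t ht ↦
    ⟨(hm _ (hswept t ht)).1, congr(NEH.CVec.re $(hlie _ (hswept t ht)))⟩
  have hf : NEH.IsDraggedAlong l (NEH.imField m) γ (Set.uIcc a b) := fun t ht ↦
    ⟨(hm _ (hswept t ht)).2, congr(NEH.CVec.im $(hlie _ (hswept t ht)))⟩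
  have ha : a ∈ Set.uIcc a b := Set.left_mem_uIcc
  have hb : b ∈ Set.uIcc a b := Set.right_mem_uIcc
  obtain ⟨hF, h1, h2, h3⟩ := NEH.isNullTetrad_iff.1 (htetrad p hp)
  rw [← hγa] at hF h1 h2 h3
  have hle := hl.inner_dragged_eq_zero hD hγ hγH he τ hψ.embedding ha hF.le
  have hlf := hl.inner_dragged_eq_zero hD hγ hγH hf τ hψ.embedding ha hF.lf
  obtain ⟨k1, k2, k3⟩ := hψ.inner_dragged_eq hl hD hγ hγH he hf ha hle hlf hF.det b hb
  have hlm : NEH.CVec.bilin (g.inner (γ b)) (NEH.CVec.ofReal (l (γ b))) (m (γ b)) = 0 :=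
    NEH.CVec.bilin_eq_zero_iff.2 ⟨hle b hb, hlf b hb⟩
  obtain ⟨hmm, hmm'⟩ := NEH.bilin_self_and_conj_iff.2 ⟨k1.trans h1, k2.trans h2, k3.trans h3⟩
  have hy := hγH b hb
  have hsymm := hl.inner_conn_symm hy hD τ hψ.embedding (hle b hb) (hlf b hb)
  have ce := hl.conn_dragged hy hD (he b hb).1 (he b hb).2
  have cf := hl.conn_dragged hy hD (hf b hb).1 (hf b hb).2
  rw [hγb] at hlm hmm hmm' hy hsymm ce cf
  refine ⟨hlm, hmm, hmm', NEH.existsUnique_isNullTetrad (hl.inner_time_ne_zero hy τ)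
    (hl.inner_self hy) hlm hmm hmm', fun k _ ↦ ?_⟩
  rw [sub_eq_zero, eq_comm, Complex.conj_eq_iff_im, NEH.spinEpsilon]
  have hre : NEH.reField m x = (m x).re := rfl
  have him : NEH.imField m x = (m x).im := rfl
  -- After `∇_l m = ∇_m l`, this imaginary part is `B(Im m, Re m) - B(Re m, Im m)`. The other term
  -- of `ε` is real.
  have h0 : (NEH.CVec.bilin (g.inner x) (m x).conj (NEH.covC D m x (l x))).im = 0 := by
    simp only [NEH.CVec.bilin, NEH.CVec.conj, NEH.covC, ce, cf, map_neg, neg_apply, hre, him]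
      at hsymm ⊢
    rw [g.symm x (m x).re, g.symm x (m x).im]
    linarith
  simp [h0]
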